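/- **Setting.** All matrices are finite complex matrices, $\|\cdot\|$ is the operator norm, $d\ge 1$. * An *$\epsilon$-soft torus* is a tuple of unitaries $\mathcal U=(U_1,\dots,U_d)$ with $\|[U_i,U_j]\|\le\epsilon$ for all $i,j$. For two soft tori, $\mathrm{dist}(\mathcal U,\mathcal V)=\inf_Y\max_i\|Y^\dagger U_iY-V_i\|$ over unitaries $Y$. * An *$\epsilon$-local projector* $\mathcal P$ consists of commuting unitaries $U_1,\dots,U_d$ and an orthogonal projector $P$ with $\|[P,U_i]\|\le\epsilon$ for all $i$; it is *trivial* if $[P,U_i]=0$ for all $i$. Sums of local projectors are direct sums of matrices. * For local projectors $\mathcal P,\mathcal Q$ whose projectors have equal rank (their sizes may differ), $\mathrm{dist}(\mathcal P,\mathcal Q)$ is the infimum, over trivial local projectors $\mathcal R,\mathcal S$ such that the projectors $p,q$ of $\mathcal P+\mathcal R$ and $\mathcal Q+\mathcal S$ have equal size and equal rank, and over unitaries $Y$ with $Y^\dagger pY=q$, of $\max_i\|Y^\dagger u_iY-v_i\|$, where $u_i,v_i$ are the unitaries of $\mathcal P+\mathcal R$ and $\mathcal Q+\mathcal S$. * $\mathrm{polar}(X)=X(X^\dagger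 X)^{-1/2}$ for invertible $X$. * *The map $\mathcal G$.* For an $\epsilon$-local projector $\mathcal P$ with $\epsilon<0.6$, choose an orthonormal basis of the range of $P$, let $U_i^{11}$ be the compression of $U_i$ to the range of $P$ written in this basis, and put $\mathcal G\mathcal P=(\mathrm{polar}(U_1^{11}),\dots,\mathrm{polar}(U_d^{11}))$. * *The map $\mathcal F$.* Fix $F:\mathbb R\to[0,\infty)$ with $F(x)=0$ for $|x|\ge1$, $F(x-1)+F(x)+F(x+1)=1$ for $|x|\le 1$, and $F^{1/2}\in C^\infty$. For an $\epsilon$-soft torus $(U_1,\dots,U_d)$ on $\mathcal H$ with $\epsilon>0$, put $\Delta=\sqrt{d\epsilon}$, $X_i=\frac{U_i+U_i^\dagger}2$, $Y_i=\frac{U_i-U_i^\dagger}{2i}$, and for integer vectors $\vec m,\vec n$ with entries of absolute value at most $\lceil1/\Delta\rceil$ put $E_{\vec m,\vec n}=A_{\vec m,\vec n}A_{\vec m,\vec n}^\dagger$, where $$A_{\vec m,\vec n}=F(\tfrac{X_1}\Delta-m_1)^{1/2}\cdots F(\tfrac{X_d}\Delta-m_d)^{1/2}F(\tfrac{Y_1}\Delta-n_1)^{1/2}\cdots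 F(\tfrac{Y_d}\Delta-n_d)^{1/2}.$$ Choose a finite-dimensional Naimark dilation of this POVM: a space $\mathcal H'\supset\mathcal H$ and mutually orthogonal projectors $Q_{\vec m,\vec n}$ on $\mathcal H'$ with sum $I$ and $\Pi Q_{\vec m,\vec n}\Pi|_{\mathcal H}=E_{\vec m,\vec n}$, where $\Pi$ is the projector onto $\mathcal H$. Put $V_i=\sum_{\vec m,\vec n}(m_i+\mathrm i\,n_i)\Delta\,Q_{\vec m,\vec n}$, choose $z\in\mathbb C$ with $|z|=1$ such that $V_i+xz$ is invertible for all $i$ and all $0<x\le1$, and put $U_i'=\lim_{x\to0^+}\mathrm{polar}(V_i+xz)$. The value of $\mathcal F$ is given by the projector $\Pi$ and the matrices $U_1',\dots,U_d'$. **Statement.** 1. There is an absolute constant $C>0$ such that for all $d\ge1$, all $\epsilon<0.6$ and all $\epsilon$-local projectors $\mathcal P,\mathcal Q$ (of possibly different sizes) whose projectors have the same rank, $$\mathrm{dist}(\mathcal P,\mathcal Q)\le\mathrm{dist}(\mathcal G\mathcal P,\mathcal G\mathcal Q)+C\epsilon .$$ 2. For every $F$ as above there are constants $C>0$ and $0<\epsilon_0<0.6$,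 depending only on $F$, such that for all $d\ge1$, all $0<\epsilon\le\epsilon_0$ and every $\epsilon$-local projector $\mathcal P$: $\mathcal G\mathcal P$ is a $4\epsilon^2$-soft torus; regarding it as such, $\mathcal F$ can be applied to it (the choices in its definition are possible); and, for all choices made in the definitions of $\mathcal G$ and $\mathcal F$, $\mathcal F\circ\mathcal G\,\mathcal P$ is a $C\,d^{1/4}\epsilon^{1/2}$-local projector, its projector has the same rank as that of $\mathcal P$, and $$\mathrm{dist}(\mathcal P,\mathcal F\circ\mathcal G\,\mathcal P)\le C\,(d\epsilon)^{1/4}.$$ -/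

import Mathlib

open scoped Matrix.Norms.L2Operator ContDiff
open Matrix Filter Topology

noncomputable section

/-! All matrices are complex and finite; `‖ ‖` on square matrices is the operator norm (the norm of
the map between Euclidean spaces). Tuples are indexed by `Fin d`, and a matrix
`Y : Matrix ι κ ℂ` between two index types that satisfies `IsUnitaryMap Y` is a unitary matrix
up to relabelling of rows and columns (in particular the two index types have the same size). -/

/-- A unitary matrix whose rows and columns are labelled by possibly different index types. -/
def IsUnitaryMap {ι κ : Type*} [Fintype ι] [DecidableEq ι] [Fintype κ] [DecidableEq κ]
    (Y : Matrix ι κ ℂ) : Prop :=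
  Yᴴ * Y = 1 ∧ Y * Yᴴ = 1

/-- An `ε`-soft torus: unitaries `U_1, …, U_d` with `‖[U_i, U_j]‖ ≤ ε`. -/
def IsSoftTorus {d : ℕ} {ι : Type*} [Fintype ι] [DecidableEq ι]
    (ε : ℝ) (U : Fin d → Matrix ι ι ℂ) : Prop :=
  (∀ i, U i ∈ Matrix.unitaryGroup ι ℂ) ∧ ∀ i j, ‖U i * U j - U j * U i‖ ≤ ε

/-- The distance between soft tori: the infimum over unitaries `Y` of
`max_i ‖Y† U_i Y - V_i‖` (it is `⊤` when the sizes differ). -/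
def torusDist {d : ℕ} {ι κ : Type*} [Fintype ι] [DecidableEq ι] [Fintype κ] [DecidableEq κ]
    (U : Fin d → Matrix ι ι ℂ) (V : Fin d → Matrix κ κ ℂ) : ENNReal :=
  ⨅ (Y : Matrix ι κ ℂ) (_ : IsUnitaryMap Y), ⨆ i, ENNReal.ofReal ‖Yᴴ * U i * Y - V i‖

/-- The raw data of a local projector: matrices `U_1, …, U_d` and a matrix `P`. -/
structure ProjTuple (d : ℕ) (ι : Type*) where
  /-- the matrices that will be commuting unitaries -/
  U : Fin d → Matrix ι ι ℂ
  /-- the matrix that will be an orthogonal projector -/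
  P : Matrix ι ι ℂ

namespace ProjTuple

variable {d : ℕ} {ι κ : Type*} [Fintype ι] [DecidableEq ι] [Fintype κ] [DecidableEq κ]

/-- The exact conditions: the `U_i` are commuting unitaries and `P` is an orthogonal projector. -/
structure IsExact (L : ProjTuple d ι) : Prop where
  unitary : ∀ i, L.U i ∈ Matrix.unitaryGroup ι ℂ
  commute : ∀ i j, L.U i * L.U j = L.U j * L.U i
  projector : IsStarProjection L.P

/-- An `ε`-local projector: moreover `‖[P, U_i]‖ ≤ ε`. -/
def IsLocal (ε : ℝ) (L : ProjTuple d ι) : Prop :=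
  L.IsExact ∧ ∀ i, ‖L.P * L.U i - L.U i * L.P‖ ≤ ε

/-- A trivial local projector: `P` exactly commutes with the `U_i`. -/
def IsTrivial (L : ProjTuple d ι) : Prop :=
  L.IsExact ∧ ∀ i, L.P * L.U i = L.U i * L.P

/-- The direct sum of two local projectors. -/
def add (L : ProjTuple d ι) (M : ProjTuple d κ) : ProjTuple d (ι ⊕ κ) where
  U i := Matrix.fromBlocks (L.U i) 0 0 (M.U i)
  P := Matrix.fromBlocks L.P 0 0 M.P

/-- The infimum over unitaries `Y` with `Y† p Y = q` of `max_i ‖Y† u_i Y - v_i‖`, where `(u, p)`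
and `(v, q)` are the two arguments. It is `⊤` unless `p` and `q` have the same size and rank. -/
def dist₀ (L : ProjTuple d ι) (M : ProjTuple d κ) : ENNReal :=
  ⨅ (Y : Matrix ι κ ℂ) (_ : IsUnitaryMap Y ∧ Yᴴ * L.P * Y = M.P),
    ⨆ i, ENNReal.ofReal ‖Yᴴ * L.U i * Y - M.U i‖

/-- The distance between local projectors: the infimum of `dist₀ (L + R) (M + S)` over all trivial
local projectors `R` and `S`, of arbitrary sizes `a` and `b`. Pairs for which the two sums do not
have the same size and rank contribute `⊤`, that is, nothing. -/
def dist (L : ProjTuple d ι) (M : ProjTuple d κ) : ENNReal :=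
  ⨅ (a : ℕ) (b : ℕ) (R : ProjTuple d (Fin a)) (S : ProjTuple d (Fin b))
    (_ : R.IsTrivial ∧ S.IsTrivial), dist₀ (L.add R) (M.add S)

end ProjTuple

/-- `polar X = X (X† X)^{-1/2}`, for invertible `X`. -/
def polar {ι : Type*} [Fintype ι] [DecidableEq ι] (X : Matrix ι ι ℂ) : Matrix ι ι ℂ :=
  X * cfc (fun t : ℝ => t ^ (-(1 / 2) : ℝ)) (Xᴴ * X)

/-- `T` is a value of the map `𝒢` at the local projector `L`. The columns of `W` form an
orthonormal basis of the range of `P`, so `W† U_i W` is the corner `U_i^{11}` of `U_i` in a basis in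
which `P` is `diag(I, 0)`; different bases give unitarily conjugate values. -/
def IsMapG {d : ℕ} {ι ρ : Type*} [Fintype ι] [DecidableEq ι] [Fintype ρ] [DecidableEq ρ]
    (L : ProjTuple d ι) (T : Fin d → Matrix ρ ρ ℂ) : Prop :=
  ∃ W : Matrix ι ρ ℂ, Wᴴ * W = 1 ∧ W * Wᴴ = L.P ∧ ∀ i, T i = polar (Wᴴ * L.U i * W)

/-- The window functions `F` allowed in the construction of the map `ℱ`. -/
structure IsWindow (F : ℝ → ℝ) : Prop where
  nonneg : ∀ x, 0 ≤ F x
  support : ∀ x, 1 ≤ |x| → F x = 0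
  sum_eq_one : ∀ x, |x| ≤ 1 → F (x - 1) + F x + F (x + 1) = 1
  smooth_sqrt : ContDiff ℝ ∞ (fun x => √(F x))

/-- The Hermitian part `X = (U + U†) / 2`. -/
def rePart {ι : Type*} (U : Matrix ι ι ℂ) : Matrix ι ι ℂ := (2 : ℂ)⁻¹ • (U + Uᴴ)

/-- The skew part `Y = (U - U†) / (2 i)`. -/
def imPart {ι : Type*} (U : Matrix ι ι ℂ) : Matrix ι ι ℂ := (2 * Complex.I)⁻¹ • (U - Uᴴ)

/-- The index set of the POVM: pairs `(m, n)` of integer vectors with entries of absolute value at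
most `⌈1/Δ⌉`. -/
abbrev PovmIndex (d : ℕ) (Δ : ℝ) : Type :=
  (Fin d → Finset.Icc (-⌈1 / Δ⌉) ⌈1 / Δ⌉) × (Fin d → Finset.Icc (-⌈1 / Δ⌉) ⌈1 / Δ⌉)

/-- `F(X/Δ - k)^{1/2}` for a Hermitian matrix `X`. -/
def windowOp {ι : Type*} [Fintype ι] [DecidableEq ι] (F : ℝ → ℝ) (Δ : ℝ) (X : Matrix ι ι ℂ)
    (k : ℤ) : Matrix ι ι ℂ :=
  cfc (fun x : ℝ => √(F (x / Δ - k))) X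

/-- The ordered product
`F(X_1/Δ - m_1)^{1/2} ⋯ F(X_d/Δ - m_d)^{1/2} F(Y_1/Δ - n_1)^{1/2} ⋯ F(Y_d/Δ - n_d)^{1/2}`. -/
def povmA {d : ℕ} {ι : Type*} [Fintype ι] [DecidableEq ι] (F : ℝ → ℝ) (Δ : ℝ)
    (T : Fin d → Matrix ι ι ℂ) (k : PovmIndex d Δ) : Matrix ι ι ℂ :=
  (List.ofFn fun i => windowOp F Δ (rePart (T i)) (k.1 i)).prod *
    (List.ofFn fun i => windowOp F Δ (imPart (T i)) (k.2 i)).prod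

/-- The POVM element `E_{m,n} = A_{m,n} A_{m,n}†`. -/
def povmE {d : ℕ} {ι : Type*} [Fintype ι] [DecidableEq ι] (F : ℝ → ℝ) (Δ : ℝ)
    (T : Fin d → Matrix ι ι ℂ) (k : PovmIndex d Δ) : Matrix ι ι ℂ :=
  povmA F Δ T k * (povmA F Δ T k)ᴴ

/-- A Naimark dilation of the POVM `E` on `ℂ^ι` to `ℂ^κ`: an isometry `W` from `ℂ^ι` into `ℂ^κ`
and mutually orthogonal projectors `Q k` on `ℂ^κ` that sum to the identity, whose compressions to
the copy of `ℂ^ι` are the `E k`. -/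
structure IsNaimark {α ι κ : Type*} [Fintype α] [Fintype ι] [DecidableEq ι] [Fintype κ]
    [DecidableEq κ] (E : α → Matrix ι ι ℂ) (W : Matrix κ ι ℂ) (Q : α → Matrix κ κ ℂ) : Prop where
  isometry : Wᴴ * W = 1
  projector : ∀ k, IsStarProjection (Q k)
  orthogonal : ∀ k l, k ≠ l → Q k * Q l = 0
  complete : ∑ k, Q k = 1
  compress : ∀ k, Wᴴ * Q k * W = E k

/-- The normal matrix `V_i = X'_i + i Y'_i`, with `X'_i = ∑ m_i Δ Q_{m,n}` and
`Y'_i = ∑ n_i Δ Q_{m,n}`. -/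
def dilatedV {d : ℕ} {κ : Type*} {Δ : ℝ} (Q : PovmIndex d Δ → Matrix κ κ ℂ) (i : Fin d) :
    Matrix κ κ ℂ :=
  (∑ k : PovmIndex d Δ, (((k.1 i : ℤ) : ℂ) * (Δ : ℂ)) • Q k) +
    Complex.I • ∑ k : PovmIndex d Δ, (((k.2 i : ℤ) : ℂ) * (Δ : ℂ)) • Q k

/-- `L` is a value of the map `ℱ` (built with the window `F`) at the `ε`-soft torus `T`, for some
choice of the Naimark dilation and of the phase `z`. Here `Δ = √(d ε)`, the projector of `L`
projects onto the copy of the original space, and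
`U'_i = lim_{x → 0+} polar (V_i + x z)`. -/
def IsMapF {d : ℕ} {ι κ : Type*} [Fintype ι] [DecidableEq ι] [Fintype κ] [DecidableEq κ]
    (F : ℝ → ℝ) (ε : ℝ) (T : Fin d → Matrix ι ι ℂ) (L : ProjTuple d κ) : Prop :=
  ∃ (W : Matrix κ ι ℂ) (Q : PovmIndex d √(d * ε) → Matrix κ κ ℂ) (z : ℂ),
    IsNaimark (povmE F √(d * ε) T) W Q ∧
    ‖z‖ = 1 ∧
    (∀ i, ∀ x : ℝ, 0 < x → x ≤ 1 → IsUnit (dilatedV Q i + ((x : ℂ) * z) • 1)) ∧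
    L.P = W * Wᴴ ∧
    ∀ i, Tendsto (fun x : ℝ => polar (dilatedV Q i + ((x : ℂ) * z) • 1)) (𝓝[>] 0) (𝓝 (L.U i))

end

/-! Write the projector as `W * Wᴴ` with `W` an isometry. Almost commuting with `P` means that each
unitary has off-diagonal blocks of norm at most `ε`, so what matters is its corner `Wᴴ * U * W`.
This is `dist_le_of_corner_close`: adjoin to `L` the unitaries of `M` with projector `0`, and to `M`
those of `L`, and conjugate by a unitary that exchanges the two ranges and matches the complementary
blocks with themselves. The error is then the distance of the corners plus off-diagonal blocks.

A corner `A` satisfies `1 - Aᴴ * A = Bᴴ * B` with `B` an off-diagonal block. Hence `A` is within `ε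
^ 2` of its polar part, and the first claim follows. The commutator of two corners is likewise a
difference of products of two off-diagonal blocks, which makes `𝒢` produce a soft torus of order `ε
^ 2`.

For `ℱ` applied to an `ε'`-soft torus `T`, the aim is `V i * W ≈ W * T i`. A variance computation
(`norm_mul_isometry_sub_sq_le`) reduces this to two moments of the POVM: that of `v` must be close
to `T i` and that of `|v| ^ 2` close to `1`. Since `E` is built from an ordered product, its moments
arise by averaging successively over the windows of the single generators. Each averaging is a
contraction and moves a matrix `Z` by `O(‖[X, Z]‖ / Δ)`, with no factor for the number of windows
(`IsWindow.exists_norm_average_sub_le`): by orthogonality of characters the displacement is a mean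
of commutators of `Z` with twisted window sums, and these are controlled by Poisson summation.

The `2 d` averagings cost `O(d ε' / Δ)` and the grid costs `O(Δ)`, which balance at `Δ = √(d ε')`.
The variance argument turns this into `√Δ`, and replacing `V i` by its phase loses only a constant.
With `ε' = 4 ε ^ 2` the result has order `d ^ (1/4) ε ^ (1/2)`. -/

noncomputable section

set_option linter.unusedSectionVars false

/-! ### Operator norm estimates for isometries and block matrices -/

section Norms

variable {ι κ ρ : Type*} [Fintype ι] [DecidableEq ι] [Fintype κ] [DecidableEq κ]
  [Fintype ρ] [DecidableEq ρ]

theorem l2_opNorm_one_le : ‖(1 : Matrix ι ι ℂ)‖ ≤ 1 := by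
  rw [← Matrix.diagonal_one, Matrix.l2_opNorm_diagonal]
  exact (pi_norm_le_iff_of_nonneg zero_le_one).2 fun _ => by simp

theorem l2_opNorm_le_one_of_isometry {W : Matrix κ ι ℂ} (hW : Wᴴ * W = 1) : ‖W‖ ≤ 1 := by
  have h := Matrix.l2_opNorm_conjTranspose_mul_self W
  rw [hW] at h
  nlinarith [norm_nonneg W, l2_opNorm_one_le (ι := ι)]

theorem l2_opNorm_le_one_of_mem_unitaryGroup {U : Matrix ι ι ℂ}
    (hU : U ∈ Matrix.unitaryGroup ι ℂ) : ‖U‖ ≤ 1 :=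
  l2_opNorm_le_one_of_isometry (Matrix.mem_unitaryGroup_iff'.1 hU)

theorem l2_opNorm_mul_le_of_le {A : Matrix ι κ ℂ} {B : Matrix κ ρ ℂ} {a b : ℝ}
    (hA : ‖A‖ ≤ a) (hB : ‖B‖ ≤ b) : ‖A * B‖ ≤ a * b :=
  (Matrix.l2_opNorm_mul A B).trans
    (mul_le_mul hA hB (norm_nonneg _) ((norm_nonneg _).trans hA))

theorem l2_opNorm_conj_isometry_le {W : Matrix κ ι ℂ} (hW : Wᴴ * W = 1) (B : Matrix κ κ ℂ) :
    ‖Wᴴ * B * W‖ ≤ ‖B‖ := by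
  have h1 := l2_opNorm_le_one_of_isometry hW
  have h2 : ‖Wᴴ‖ ≤ 1 := by rwa [Matrix.l2_opNorm_conjTranspose]
  simpa using l2_opNorm_mul_le_of_le (l2_opNorm_mul_le_of_le h2 le_rfl) h1

theorem l2_opNorm_isometry_conj_le {W : Matrix κ ι ℂ} (hW : Wᴴ * W = 1) (B : Matrix ι ι ℂ) :
    ‖W * B * Wᴴ‖ ≤ ‖B‖ := by
  have h1 := l2_opNorm_le_one_of_isometry hW
  have h2 : ‖Wᴴ‖ ≤ 1 := by rwa [Matrix.l2_opNorm_conjTranspose]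
  simpa using l2_opNorm_mul_le_of_le (l2_opNorm_mul_le_of_le h1 le_rfl) h2

theorem l2_opNorm_le_of_forall_mulVec {A : Matrix ι κ ℂ} {c : ℝ} (hc : 0 ≤ c)
    (h : ∀ x : κ → ℂ, ∑ i, ‖(A *ᵥ x) i‖ ^ 2 ≤ c ^ 2 * ∑ j, ‖x j‖ ^ 2) : ‖A‖ ≤ c := by
  rw [Matrix.l2_opNorm_def]
  refine ContinuousLinearMap.opNorm_le_bound _ hc fun x => ?_
  refine le_of_sq_le_sq ?_ (by positivity)
  rw [mul_pow, EuclideanSpace.norm_sq_eq, EuclideanSpace.norm_sq_eq]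
  exact h x.ofLp

theorem sum_norm_mulVec_sq_le (A : Matrix ι κ ℂ) (x : κ → ℂ) :
    ∑ i, ‖(A *ᵥ x) i‖ ^ 2 ≤ ‖A‖ ^ 2 * ∑ j, ‖x j‖ ^ 2 := by
  have h := Matrix.l2_opNorm_mulVec A (WithLp.toLp 2 x)
  have h2 := pow_le_pow_left₀ (norm_nonneg _) h 2
  rw [mul_pow, EuclideanSpace.norm_sq_eq, EuclideanSpace.norm_sq_eq] at h2
  exact h2

theorem l2_opNorm_fromBlocks_diag_le {A : Matrix ι ι ℂ} {D : Matrix κ κ ℂ} {c : ℝ}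
    (hA : ‖A‖ ≤ c) (hD : ‖D‖ ≤ c) : ‖Matrix.fromBlocks A 0 0 D‖ ≤ c := by
  refine l2_opNorm_le_of_forall_mulVec ((norm_nonneg _).trans hA) fun x => ?_
  obtain ⟨x₁, x₂, rfl⟩ : ∃ x₁ x₂, x = Sum.elim x₁ x₂ :=
    ⟨x ∘ Sum.inl, x ∘ Sum.inr, (Sum.elim_comp_inl_inr x).symm⟩
  rw [Matrix.fromBlocks_mulVec]
  simp only [Sum.elim_comp_inl, Sum.elim_comp_inr, Matrix.zero_mulVec, add_zero, zero_add,
    Fintype.sum_sum_type, Sum.elim_inl, Sum.elim_inr, mul_add]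
  gcongr
  · exact (sum_norm_mulVec_sq_le A x₁).trans (by gcongr)
  · exact (sum_norm_mulVec_sq_le D x₂).trans (by gcongr)

theorem l2_opNorm_fromBlocks_antidiag_le {B : Matrix ι ρ ℂ} {C : Matrix κ ι ℂ} {c : ℝ}
    (hB : ‖B‖ ≤ c) (hC : ‖C‖ ≤ c) : ‖Matrix.fromBlocks 0 B C 0‖ ≤ c := by
  refine l2_opNorm_le_of_forall_mulVec ((norm_nonneg _).trans hB) fun x => ?_
  obtain ⟨x₁, x₂, rfl⟩ : ∃ x₁ x₂, x = Sum.elim x₁ x₂ :=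
    ⟨x ∘ Sum.inl, x ∘ Sum.inr, (Sum.elim_comp_inl_inr x).symm⟩
  rw [Matrix.fromBlocks_mulVec]
  simp only [Sum.elim_comp_inl, Sum.elim_comp_inr, Matrix.zero_mulVec, add_zero, zero_add,
    Fintype.sum_sum_type, Sum.elim_inl, Sum.elim_inr, mul_add]
  rw [add_comm]
  gcongr
  · exact (sum_norm_mulVec_sq_le C x₁).trans (by gcongr)
  · exact (sum_norm_mulVec_sq_le B x₂).trans (by gcongr)

end Norms

/-! ### Functional calculus through star homomorphisms from `α → ℂ` -/

section FunctionalCalculus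

variable {α ι : Type*} [Fintype α] [Fintype ι] [DecidableEq ι]

/-- The star homomorphism `g ↦ diag g`. -/
def diagonalStarAlgHom (ι : Type*) [Fintype ι] [DecidableEq ι] :
    (ι → ℂ) →⋆ₐ[ℂ] Matrix ι ι ℂ :=
  { Matrix.diagonalAlgHom ℂ with
    map_star' := fun g => by
      simp [Matrix.star_eq_conjTranspose, Matrix.diagonal_conjTranspose] }

/-- The spectral theorem, packaged so that identities and norms of functions of `X` can be checked
pointwise on eigenvalues. -/
theorem Matrix.IsHermitian.exists_starAlgHom {X : Matrix ι ι ℂ} (hX : X.IsHermitian) :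
    ∃ (φ : (ι → ℂ) →⋆ₐ[ℂ] Matrix ι ι ℂ) (t : ι → ℝ),
      φ (fun a => (t a : ℂ)) = X ∧ ∀ g, ‖φ g‖ = ‖g‖ := by
  let e := Unitary.conjStarAlgAut ℂ (Matrix ι ι ℂ) hX.eigenvectorUnitary
  refine ⟨(e : Matrix ι ι ℂ →⋆ₐ[ℂ] Matrix ι ι ℂ).comp (diagonalStarAlgHom ι), hX.eigenvalues,
    ?_, fun g => ?_⟩
  · exact hX.spectral_theorem.symm
  · have : ‖e (Matrix.diagonal g)‖ = ‖Matrix.diagonal g‖ := StarAlgEquiv.norm_map e _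
    rw [Matrix.l2_opNorm_diagonal] at this
    exact this

/-- No continuity of `f` is needed: on the finitely many values of `t` it equals an interpolating
polynomial, and star homomorphisms respect polynomials. Since `φ` may fail to be injective, the
spectrum is only shown to lie among the values of `t`. -/
theorem cfc_starAlgHom_ofReal (φ : (α → ℂ) →⋆ₐ[ℂ] Matrix ι ι ℂ) (t : α → ℝ) (f : ℝ → ℝ) :
    cfc f (φ fun a => (t a : ℂ)) = φ fun a => (f (t a) : ℂ) := by
  classical
  obtain ⟨p, hp⟩ : ∃ p : Polynomial ℝ, ∀ a, p.eval (t a) = f (t a) := by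
    refine ⟨Lagrange.interpolate (Finset.univ.image t) id f, fun a => ?_⟩
    exact Lagrange.eval_interpolate_at_node f (fun _ _ _ _ h => h)
      (Finset.mem_image_of_mem t (Finset.mem_univ a))
  have hsa : IsSelfAdjoint (φ fun a => (t a : ℂ)) := by
    rw [IsSelfAdjoint, ← map_star]
    congr 1
    ext a
    simp
  have hev : ∀ q : Polynomial ℝ, Polynomial.aeval (φ fun a => (t a : ℂ)) q =
      φ fun a => ((q.eval (t a) : ℝ) : ℂ) := by
    intro q
    have h1 := Polynomial.aeval_algHom_apply ((φ : (α → ℂ) →ₐ[ℂ] Matrix ι ι ℂ).restrictScalars ℝ)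
      (fun a => (t a : ℂ)) q
    refine h1.trans (congrArg φ ?_)
    ext a
    have h2 := Polynomial.aeval_algHom_apply (Pi.evalAlgHom ℝ (fun _ : α => ℂ) a)
      (fun a => (t a : ℂ)) q
    have h3 : Polynomial.aeval ((t a : ℝ) : ℂ) q = ((q.eval (t a) : ℝ) : ℂ) :=
      Polynomial.aeval_algebraMap_apply_eq_algebraMap_eval (A := ℂ) (t a) q
    exact h2.symm.trans h3
  have hspec : Set.EqOn f p.eval (spectrum ℝ (φ fun a => (t a : ℂ))) := by
    intro x hx
    by_contra hne
    refine hx ?_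
    have hxt : ∀ a, (x : ℂ) - t a ≠ 0 := by
      intro a h
      refine hne ?_
      have : x = t a := by exact_mod_cast sub_eq_zero.1 h
      rw [this]
      exact (hp a).symm
    have hu : IsUnit (fun a => (x : ℂ) - t a) :=
      Pi.isUnit_iff.2 fun a => (hxt a).isUnit
    have h4 := hu.map φ
    have h5 : algebraMap ℝ (Matrix ι ι ℂ) x - φ (fun a => (t a : ℂ)) =
        φ (fun a => (x : ℂ) - t a) := by
      have h6 : algebraMap ℝ (Matrix ι ι ℂ) x = φ (fun _ => (x : ℂ)) := by
        have := AlgHomClass.commutes φ (x : ℂ)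
        exact this.symm
      rw [h6, ← map_sub]
      rfl
    rw [spectrum.mem_resolventSet_iff, h5]
    exact h4
  rw [cfc_congr hspec, cfc_polynomial (R := ℝ) p _ hsa, hev]
  simp_rw [hp]

/-- The functional calculus `c ↦ ∑ c k • Q k` of a resolution of the identity. -/
def resolutionStarAlgHom (Q : α → Matrix ι ι ℂ) (hQ : ∀ k, IsStarProjection (Q k))
    (ho : ∀ k l, k ≠ l → Q k * Q l = 0) (h1 : ∑ k, Q k = 1) :
    (α → ℂ) →⋆ₐ[ℂ] Matrix ι ι ℂ where
  toFun c := ∑ k, c k • Q k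
  map_one' := by simpa using h1
  map_mul' c c' := by
    rw [Finset.sum_mul_sum]
    refine Finset.sum_congr rfl fun k _ => ?_
    rw [Finset.sum_eq_single k]
    · rw [smul_mul_smul_comm, (hQ k).isIdempotentElem]
      rfl
    · intro l _ hl
      rw [smul_mul_smul_comm, ho k l hl.symm, smul_zero]
    · simp
  map_zero' := by simp
  map_add' c c' := by simp [add_smul, Finset.sum_add_distrib]
  commutes' r := by
    rw [Algebra.algebraMap_eq_smul_one r (A := Matrix ι ι ℂ), ← h1, Finset.smul_sum]
    rfl
  map_star' c := by
    rw [star_sum]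
    refine Finset.sum_congr rfl fun k _ => ?_
    rw [star_smul, (hQ k).isSelfAdjoint.star_eq]
    rfl

/-- Duhamel: the derivative in `r` of `e^{-irX} Z e^{irX}` is, up to a unit factor, a conjugate of
`[X, Z]`, so its norm is at most `‖[X, Z]‖`. The mean value inequality on `[0, s]` gives the factor
`|s|`. -/
theorem norm_commutator_exp_le {φ : (α → ℂ) →⋆ₐ[ℂ] Matrix ι ι ℂ} (t : α → ℝ) (s : ℝ)
    (Z : Matrix ι ι ℂ) :
    ‖φ (fun a => Complex.exp (Complex.I * (s * t a))) * Z -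
        Z * φ (fun a => Complex.exp (Complex.I * (s * t a)))‖ ≤
      |s| * ‖φ (fun a => (t a : ℂ)) * Z - Z * φ (fun a => (t a : ℂ))‖ := by
  set X := φ (fun a => (t a : ℂ)) with hX
  let Φ : (α → ℂ) →L[ℝ] Matrix ι ι ℂ :=
    LinearMap.toContinuousLinearMap ((φ : (α → ℂ) →ₗ[ℂ] Matrix ι ι ℂ).restrictScalars ℝ)
  have hΦ : ∀ g, Φ g = φ g := fun g => rfl
  let e : ℝ → α → ℂ := fun r a => Complex.exp (Complex.I * (r * t a))
  have he : ∀ r, HasDerivAt e (fun a => e r a * (Complex.I * t a)) r := by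
    intro r
    rw [hasDerivAt_pi]
    intro a
    have h1 : HasDerivAt (fun r : ℝ => Complex.I * ((r : ℂ) * t a)) (Complex.I * (1 * t a)) r :=
      ((Complex.ofRealCLM.hasDerivAt (x := r)).mul_const (t a : ℂ)).const_mul Complex.I
    simpa using! h1.cexp
  have hu : ∀ r, HasDerivAt (fun r => φ (e r)) (φ (e r) * (Complex.I • X)) r := by
    intro r
    have h1 := Φ.hasFDerivAt.comp_hasDerivAt r (he r)
    have h2 : Φ (fun a => e r a * (Complex.I * t a)) = φ (e r) * (Complex.I • X) := by
      rw [hΦ, hX, ← map_smul, ← map_mul]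
      rfl
    rw [← h2]
    exact h1
  have hneg : ∀ r, φ (e r) * φ (e (-r)) = 1 := by
    intro r
    rw [← map_mul, ← map_one φ]
    congr 1
    ext a
    simp only [e, Pi.mul_apply, Pi.one_apply]
    rw [← Complex.exp_add]
    simp
  have hnorm : ∀ r, ‖φ (e r)‖ ≤ 1 := by
    intro r
    refine (NonUnitalStarAlgHom.norm_apply_le φ _).trans
      ((pi_norm_le_iff_of_nonneg zero_le_one).2 fun a => ?_)
    have : Complex.I * (r * t a) = ((r * t a : ℝ) : ℂ) * Complex.I := by push_cast; ring
    simp only [e]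
    rw [this, Complex.norm_exp_ofReal_mul_I]
  have hcomm : ∀ r, φ (e r) * X = X * φ (e r) := by
    intro r
    rw [hX, ← map_mul, ← map_mul, mul_comm]
  have hv : ∀ r, HasDerivAt (fun r => φ (e (-r))) (-(φ (e (-r)) * (Complex.I • X))) r := by
    intro r
    have := (hu (-r)).scomp r (hasDerivAt_neg r)
    simpa using! this
  have hh : ∀ r, HasDerivAt (fun r => φ (e (-r)) * Z * φ (e r))
      (-(Complex.I • (φ (e (-r)) * (X * Z - Z * X) * φ (e r)))) r := by
    intro r
    have := ((hv r).mul_const Z).mul (hu r)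
    convert! this using 1
    simp only [Algebra.mul_smul_comm, Algebra.smul_mul_assoc, neg_mul, mul_sub, sub_mul, smul_sub]
    rw [hcomm r]
    simp only [mul_assoc]
    abel
  have hb := Convex.norm_image_sub_le_of_norm_hasDerivWithin_le
    (C := ‖X * Z - Z * X‖) (s := Set.univ) (x := 0) (y := s)
    (fun r _ => (hh r).hasDerivWithinAt) (fun r _ => ?_) convex_univ trivial trivial
  · have hz : φ (e 0) = 1 := by
      rw [← map_one φ]
      congr 1
      ext a
      simp [e]
    have h7 : φ (e s) * Z - Z * φ (e s) =
        -(φ (e s) * (φ (e (-s)) * Z * φ (e s) - φ (e (-0)) * Z * φ (e 0))) := by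
      rw [neg_zero, hz, mul_sub, ← mul_assoc, ← mul_assoc, hneg]
      simp
    change ‖φ (e s) * Z - Z * φ (e s)‖ ≤ _
    rw [h7, norm_neg]
    refine (l2_opNorm_mul_le_of_le (hnorm s) hb).trans_eq ?_
    rw [sub_zero, one_mul, Real.norm_eq_abs, mul_comm]
  · rw [norm_neg, norm_smul, Complex.norm_I, one_mul]
    simpa using l2_opNorm_mul_le_of_le
      (l2_opNorm_mul_le_of_le (hnorm (-r)) (le_refl ‖X * Z - Z * X‖)) (hnorm r)

end FunctionalCalculus

/-! ### Poisson summation for the windows -/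

open scoped FourierTransform SchwartzMap in
/-- The quasi-periodization `∑ m, e^{2π i m θ} √F(y - m)` of the window is a Fourier series with
frequencies in `ℤ + θ` whose coefficients have a first moment bounded uniformly in `θ`. -/
theorem IsWindow.exists_fourier_expansion {F : ℝ → ℝ} (hF : IsWindow F) :
    ∃ K : ℝ, 0 < K ∧ ∀ θ : ℝ, 0 ≤ θ → θ ≤ 1 → ∃ c : ℤ → ℂ,
      Summable (fun n => ‖c n‖ * (1 + |n + θ|)) ∧ ∑' n, ‖c n‖ * (1 + |n + θ|) ≤ K ∧
      ∀ y : ℝ, HasSum (fun n : ℤ => c n * Complex.exp (Complex.I * ((2 * Real.pi * (n + θ) * y : ℝ))))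
        (∑' m : ℤ, Complex.exp (Complex.I * ((2 * Real.pi * m * θ : ℝ))) * (√(F (y - m)) : ℂ)) := by
  have hsm : ContDiff ℝ ∞ (fun x => (√(F x) : ℂ)) := Complex.ofRealCLM.contDiff.comp hF.smooth_sqrt
  have hcs : HasCompactSupport (fun x => (√(F x) : ℂ)) := by
    refine HasCompactSupport.of_support_subset_isCompact (isCompact_Icc (a := (-1 : ℝ)) (b := 1))
      fun x hx => ?_
    by_contra h
    refine hx ?_
    have : 1 ≤ |x| := by
      by_contra h1
      exact h (abs_le.1 (not_le.1 h1).le)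
    simp [hF.support x this]
  set f₀ : 𝓢(ℝ, ℂ) := hcs.toSchwartzMap hsm with hf₀
  obtain ⟨C₀, hC₀, h₀⟩ := (𝓕 f₀).decay 0 0
  obtain ⟨C₃, hC₃, h₃⟩ := (𝓕 f₀).decay 3 0
  simp only [norm_iteratedFDeriv_zero, pow_zero, one_mul, Real.norm_eq_abs] at h₀ h₃
  set C := 8 * (C₀ + C₃) with hC
  -- Third-order decay pays for the weight `1 + |ξ|` and still leaves a summable inverse square.
  have hdec : ∀ ξ : ℝ, ‖𝓕 f₀ ξ‖ * (1 + |ξ|) ≤ C / (1 + |ξ|) ^ 2 := by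
    intro ξ
    rw [le_div_iff₀ (by positivity)]
    have h1 := h₀ ξ
    have h2 := h₃ ξ
    have h3 : (1 + |ξ|) ^ 3 ≤ 8 * (1 + |ξ| ^ 3) := by
      have := abs_nonneg ξ
      nlinarith [mul_nonneg (add_nonneg zero_le_one this) (sq_nonneg (|ξ| - 1))]
    have h4 := mul_le_mul_of_nonneg_left h3 (norm_nonneg (𝓕 f₀ ξ))
    nlinarith
  -- A majorant independent of `θ`: every `θ` in `[0, 1]` is within distance `1` of `1 / 2`, and `n
  -- + 1 / 2` never vanishes.
  have hsum : Summable (fun n : ℤ => 4 * C / |(n : ℝ) + 1 / 2| ^ (2 : ℝ)) := by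
    simpa [div_eq_mul_inv] using
      ((Real.summable_one_div_int_add_rpow (1 / 2) 2).2 one_lt_two).mul_left (4 * C)
  have hle : ∀ θ : ℝ, 0 ≤ θ → θ ≤ 1 → ∀ n : ℤ,
      ‖𝓕 f₀ (n + θ)‖ * (1 + |n + θ|) ≤ 4 * C / |(n : ℝ) + 1 / 2| ^ (2 : ℝ) := by
    intro θ h0 h1 n
    refine (hdec _).trans ?_
    have hn : (n : ℝ) + 1 / 2 ≠ 0 := by
      intro h
      have h2 : (2 * n + 1 : ℝ) = 0 := by linarith
      have h3 : 2 * n + 1 = 0 := by exact_mod_cast h2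
      omega
    rw [Real.rpow_two, div_le_div_iff₀ (by positivity) (by positivity)]
    have h2 : |(n : ℝ) + 1 / 2| ≤ 2 * (1 + |n + θ|) := by
      have h3 : |(n : ℝ) + 1 / 2| ≤ |n + θ| + |1 / 2 - θ| := by
        have := abs_add_le ((n : ℝ) + θ) (1 / 2 - θ)
        rwa [show (n : ℝ) + θ + (1 / 2 - θ) = n + 1 / 2 by ring] at this
      have h4 : |1 / 2 - θ| ≤ 1 := abs_le.2 ⟨by linarith, by linarith⟩
      linarith [abs_nonneg ((n : ℝ) + θ)]
    have h5 := pow_le_pow_left₀ (abs_nonneg _) h2 2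
    have hCpos : 0 ≤ C := by positivity
    nlinarith
  refine ⟨∑' n : ℤ, 4 * C / |(n : ℝ) + 1 / 2| ^ (2 : ℝ), ?_, fun θ hθ0 hθ1 =>
    ⟨fun n => 𝓕 f₀ (n + θ), ?_, ?_, fun y => ?_⟩⟩
  · have hCpos : 0 < C := by positivity
    refine hsum.tsum_pos (fun n => by positivity) 0 ?_
    positivity
  · exact Summable.of_nonneg_of_le (fun n => by positivity) (hle θ hθ0 hθ1) hsum
  · exact Summable.tsum_le_tsum (hle θ hθ0 hθ1)
      (Summable.of_nonneg_of_le (fun n => by positivity) (hle θ hθ0 hθ1) hsum) hsum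
  · have hs := Summable.of_nonneg_of_le (fun n => by positivity) (hle θ hθ0 hθ1) hsum
    have hexp : ContDiff ℝ ∞ (fun x : ℝ => Complex.exp (Complex.I * ((-(2 * Real.pi * θ * x) : ℝ)))) :=
      (contDiff_const.mul (Complex.ofRealCLM.contDiff.comp
        (contDiff_const.mul contDiff_id).neg)).cexp
    -- Modulating by `e^{-2πiθx}` shifts the Fourier transform by `θ`, so Poisson summation for `h`
    -- yields the frequencies `n + θ`.
    set h : 𝓢(ℝ, ℂ) := (hcs.mul_right (f' := fun x : ℝ =>
      Complex.exp (Complex.I * ((-(2 * Real.pi * θ * x) : ℝ))))).toSchwartzMap (hsm.mul hexp) with hh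
    have hhv : ∀ x, h x = (√(F x) : ℂ) * Complex.exp (Complex.I * ((-(2 * Real.pi * θ * x) : ℝ))) :=
      fun x => rfl
    have hfv : ∀ x, f₀ x = (√(F x) : ℂ) := fun x => rfl
    have hfour : ∀ n : ℤ, 𝓕 h n = 𝓕 f₀ (n + θ) := by
      intro n
      rw [SchwartzMap.fourier_coe, SchwartzMap.fourier_coe, Real.fourier_real_eq_integral_exp_smul,
        Real.fourier_real_eq_integral_exp_smul]
      congr 1
      ext v
      rw [hhv, hfv, smul_eq_mul, smul_eq_mul, mul_left_comm, ← Complex.exp_add, mul_comm]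
      congr 2
      push_cast
      ring
    have hP := SchwartzMap.tsum_eq_tsum_fourier h y
    have hterm : ∀ n : ℤ, 𝓕 h n * fourier n (y : UnitAddCircle) *
        Complex.exp (Complex.I * ((2 * Real.pi * θ * y : ℝ))) =
        𝓕 f₀ (n + θ) * Complex.exp (Complex.I * ((2 * Real.pi * (n + θ) * y : ℝ))) := by
      intro n
      rw [hfour, fourier_coe_apply, mul_assoc, ← Complex.exp_add]
      congr 2
      push_cast
      ring
    have hnorm : ∀ r : ℝ, ‖Complex.exp (Complex.I * r)‖ = 1 := by
      intro r
      rw [mul_comm, Complex.norm_exp_ofReal_mul_I]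
    have hS : Summable fun n : ℤ =>
        𝓕 f₀ (n + θ) * Complex.exp (Complex.I * ((2 * Real.pi * (n + θ) * y : ℝ))) := by
      refine Summable.of_norm_bounded hs fun n => ?_
      rw [norm_mul, hnorm]
      nlinarith [norm_nonneg (𝓕 f₀ (n + θ)), abs_nonneg ((n : ℝ) + θ)]
    convert hS.hasSum using 1
    simp_rw [← hterm]
    -- Poisson summation runs over `h (y + m)`, hence the change of sign in `m`.
    rw [tsum_mul_right, ← hP, ← tsum_mul_right, ← (Equiv.neg ℤ).tsum_eq]
    congr 1
    ext m
    rw [hhv, Equiv.neg_apply]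
    push_cast
    rw [sub_neg_eq_add, mul_assoc (√(F (y + m)) : ℂ), ← Complex.exp_add, mul_comm]
    congr 2
    ring

/-! ### Averages as means of commutators -/

section Average

variable {α ι : Type*} [Fintype α] [Fintype ι] [DecidableEq ι]

/-- The map `g ↦ [φ g, Z]` is linear, so the bound for exponentials is summed along the series; the
first moment of the coefficients acts as a Lipschitz constant in the operator sense. -/
theorem norm_commutator_le_of_hasSum {φ : (α → ℂ) →⋆ₐ[ℂ] Matrix ι ι ℂ} {t : α → ℝ} {g : α → ℂ}
    {c : ℤ → ℂ} {s : ℤ → ℝ} {K : ℝ} (hc : Summable fun n => ‖c n‖ * |s n|)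
    (hK : ∑' n, ‖c n‖ * |s n| ≤ K)
    (hg : ∀ a, HasSum (fun n => c n * Complex.exp (Complex.I * (s n * t a))) (g a))
    (Z : Matrix ι ι ℂ) :
    ‖φ g * Z - Z * φ g‖ ≤ K * ‖φ (fun a => (t a : ℂ)) * Z - Z * φ (fun a => (t a : ℂ))‖ := by
  set X := φ (fun a => (t a : ℂ))
  have h1 : HasSum (fun n a => c n * Complex.exp (Complex.I * (s n * t a))) g :=
    Pi.hasSum.2 hg
  let Ψ : (α → ℂ) →L[ℂ] Matrix ι ι ℂ := LinearMap.toContinuousLinearMap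
    { toFun := fun g => φ g * Z - Z * φ g
      map_add' := fun g h => by rw [map_add, add_mul, mul_add]; abel
      map_smul' := fun r g => by simp [smul_sub] }
  have h2 := h1.mapL Ψ
  have h3 : ∀ n, ‖Ψ (fun a => c n * Complex.exp (Complex.I * (s n * t a)))‖ ≤
      ‖c n‖ * |s n| * ‖X * Z - Z * X‖ := by
    intro n
    have : (fun a => c n * Complex.exp (Complex.I * (s n * t a))) =
        c n • (fun a => Complex.exp (Complex.I * (s n * t a))) := rfl
    rw [this, map_smul, norm_smul, mul_assoc]
    exact mul_le_mul_of_nonneg_left (norm_commutator_exp_le t (s n) Z) (norm_nonneg _)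
  refine (h2.norm_le_of_bounded (hc.mul_right _).hasSum h3).trans ?_
  rw [tsum_mul_right]
  gcongr

theorem norm_le_of_hasSum_exp {g : α → ℂ} {t : α → ℝ} {c : ℤ → ℂ} {s : ℤ → ℝ} {K : ℝ}
    (hc : Summable fun n => ‖c n‖) (hK : ∑' n, ‖c n‖ ≤ K)
    (hg : ∀ a, HasSum (fun n => c n * Complex.exp (Complex.I * (s n * t a))) (g a)) :
    ‖g‖ ≤ K := by
  refine (pi_norm_le_iff_of_nonneg ((tsum_nonneg fun n => norm_nonneg _).trans hK)).2 fun a => ?_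
  refine ((hg a).norm_le_of_bounded hc.hasSum fun n => ?_).trans hK
  have : Complex.I * (s n * t a) = ((s n * t a : ℝ) : ℂ) * Complex.I := by push_cast; ring
  rw [this, norm_mul, Complex.norm_exp_ofReal_mul_I, mul_one]

/-- Orthogonality of the characters of `ℤ/L`; the bound on `m - m'` keeps distinct integers distinct
modulo `L`. -/
theorem sum_exp_mul_star_exp {L : ℕ} (hL : 0 < L) {m m' : ℤ} (h : |m - m'| < L) :
    ∑ j ∈ Finset.range L, Complex.exp (Complex.I * ((2 * Real.pi * m * (j / L) : ℝ))) *
      star (Complex.exp (Complex.I * ((2 * Real.pi * m' * (j / L) : ℝ)))) =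
      if m = m' then (L : ℂ) else 0 := by
  have hL' : (L : ℂ) ≠ 0 := by exact_mod_cast hL.ne'
  set q : ℂ := Complex.exp (2 * Real.pi * Complex.I * ((m - m' : ℤ) / L)) with hq
  have hterm : ∀ j : ℕ, Complex.exp (Complex.I * ((2 * Real.pi * m * (j / L) : ℝ))) *
      star (Complex.exp (Complex.I * ((2 * Real.pi * m' * (j / L) : ℝ)))) = q ^ j := by
    intro j
    rw [Complex.star_def, ← Complex.exp_conj, ← Complex.exp_add, hq, ← Complex.exp_nat_mul]
    congr 1
    simp only [map_mul, Complex.conj_I, Complex.conj_ofReal]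
    push_cast
    ring
  simp_rw [hterm]
  split_ifs with hm
  · simp [hq, hm]
  · have hq1 : q ≠ 1 := by
      intro h1
      obtain ⟨n, hn⟩ := Complex.exp_eq_one_iff.1 h1
      have h2 : ((m - m' : ℤ) : ℂ) = n * L := by
        have h3 : (2 * Real.pi * Complex.I : ℂ) ≠ 0 := Complex.two_pi_I_ne_zero
        have h4 : (2 * Real.pi * Complex.I : ℂ) * ((m - m' : ℤ) / L) =
            (2 * Real.pi * Complex.I) * n := by rw [hn]; ring
        have h5 := mul_left_cancel₀ h3 h4
        rwa [div_eq_iff hL'] at h5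
      have h6 : m - m' = n * L := by exact_mod_cast h2
      rw [h6, abs_mul, Nat.abs_cast] at h
      have h7 : |n| < 1 := by
        by_contra h8
        have : (L : ℤ) ≤ |n| * L := by nlinarith
        omega
      have h8 : n = 0 := by rwa [Int.abs_lt_one_iff] at h7
      rw [h8] at h6
      omega
    have hqL : q ^ L = 1 := by
      rw [hq, ← Complex.exp_nat_mul, Complex.exp_eq_one_iff]
      refine ⟨m - m', ?_⟩
      field_simp
    rw [geom_sum_eq hq1, hqL]
    simp

/-- Discrete Parseval with `G j = ∑ m, z j m • w m`: summing `G j * Z * (G j)ᴴ` over `j` kills the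
cross terms and leaves `L` times the average of `Z`, while `Z * G j * (G j)ᴴ` sums to `L • Z`. After
division by `L`, a sum over all windows has become a mean, so a uniform bound on each `G j`
suffices. -/
theorem sub_eq_average_commutator {β : Type*} [Fintype β] {J : Type*} (s : Finset J) {L : ℂ}
    {w : β → Matrix ι ι ℂ} {z : J → β → ℂ} [DecidableEq β]
    (hw : ∀ m, (w m)ᴴ = w m) (hw1 : ∑ m, w m * w m = 1)
    (hz : ∀ m m', ∑ j ∈ s, z j m * star (z j m') = if m = m' then L else 0)
    (Z : Matrix ι ι ℂ) :
    L • (∑ m, w m * Z * w m - Z) =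
      ∑ j ∈ s, ((∑ m, z j m • w m) * Z - Z * (∑ m, z j m • w m)) * (∑ m, z j m • w m)ᴴ := by
  have key : ∀ B C : Matrix ι ι ℂ, ∑ j ∈ s, C * (∑ m, z j m • w m) * B * (∑ m, z j m • w m)ᴴ =
      L • ∑ m, C * w m * B * w m := by
    intro B C
    simp_rw [Matrix.conjTranspose_sum, Matrix.conjTranspose_smul, hw, Finset.mul_sum,
      Finset.sum_mul]
    rw [Finset.sum_comm, Finset.smul_sum]
    refine Finset.sum_congr rfl fun m' _ => ?_
    rw [Finset.sum_comm]
    have : ∀ m, ∑ j ∈ s, C * (z j m • w m) * B * (star (z j m') • w m') =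
        (if m = m' then L else 0) • (C * w m * B * w m') := by
      intro m
      rw [← hz, Finset.sum_smul]
      refine Finset.sum_congr rfl fun j _ => ?_
      simp only [Matrix.mul_smul, Matrix.smul_mul, smul_smul]
      rw [mul_comm]
    simp_rw [this, ite_smul, zero_smul]
    rw [Finset.sum_ite_eq']
    simp
  have h1 := key Z 1
  have h2 := key 1 Z
  simp only [one_mul, mul_one] at h1 h2
  have h3 : ∑ m, Z * w m * w m = Z := by
    simp_rw [mul_assoc, ← Finset.mul_sum, hw1, mul_one]
  rw [h3] at h2
  simp_rw [sub_mul, Finset.sum_sub_distrib]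
  rw [h1, h2, smul_sub]

end Average

/-- Only the translates by `⌊y⌋` and `⌊y⌋ + 1` can contribute. The second leaves the index range
only for `y = N`, where it vanishes anyway. -/
theorem IsWindow.sum_translates_eq_one {F : ℝ → ℝ} (hF : IsWindow F) {y : ℝ} {N : ℤ} (hy : |y| ≤ N) :
    ∑ m : Finset.Icc (-N) N, F (y - (m : ℤ)) = 1 := by
  rw [Finset.sum_coe_sort (Finset.Icc (-N) N) (fun m : ℤ => F (y - m))]
  set p := ⌊y⌋ with hp
  have h0 : 0 ≤ y - p := sub_nonneg.2 (Int.floor_le y)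
  have h1 : y - p < 1 := by linarith [Int.lt_floor_add_one y]
  obtain ⟨hy1, hy2⟩ := abs_le.1 hy
  have hpm : p ∈ Finset.Icc (-N) N := by
    rw [Finset.mem_Icc]
    constructor
    · rw [hp, Int.le_floor]
      push_cast
      exact hy1
    · have : (p : ℝ) ≤ N := (Int.floor_le y).trans hy2
      exact_mod_cast this
  have hsum := hF.sum_eq_one (y - p) (abs_le.2 ⟨by linarith, h1.le⟩)
  have hz : F (y - p + 1) = 0 := hF.support _ (by rw [abs_of_nonneg (by linarith)]; linarith)
  have hother : ∀ m : ℤ, m ≠ p → m ≠ p + 1 → F (y - m) = 0 := by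
    intro m hm hm1
    refine hF.support _ ?_
    rcases lt_or_gt_of_ne hm with h | h
    · have : (m : ℝ) + 1 ≤ p := by exact_mod_cast h
      rw [abs_of_nonneg (by linarith)]
      linarith
    · have h2 : p + 2 ≤ m := by omega
      have : (p : ℝ) + 2 ≤ m := by exact_mod_cast h2
      rw [abs_of_nonpos (by linarith)]
      linarith
  by_cases hp1 : p + 1 ∈ Finset.Icc (-N) N
  · have hsub : ({p, p + 1} : Finset ℤ) ⊆ Finset.Icc (-N) N := by
      intro m hm
      simp only [Finset.mem_insert, Finset.mem_singleton] at hm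
      rcases hm with rfl | rfl <;> assumption
    rw [← Finset.sum_subset hsub, Finset.sum_pair (by omega)]
    · rw [show y - ((p + 1 : ℤ) : ℝ) = y - p - 1 by push_cast; ring]
      linarith
    · intro m _ hm
      simp only [Finset.mem_insert, Finset.mem_singleton, not_or] at hm
      exact hother m hm.1 hm.2
  · have hpN : (N : ℝ) ≤ p := by
      rw [Finset.mem_Icc] at hp1 hpm
      have : N ≤ p := by omega
      exact_mod_cast this
    have hyp : y - p = 0 := by linarith
    rw [Finset.sum_eq_single p]
    · rw [hz, hyp, hF.support (0 - 1) (by norm_num)] at hsum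
      rw [hyp]
      linarith
    · intro m hm hmp
      refine hother m hmp ?_
      rintro rfl
      exact hp1 hm
    · exact fun h => absurd hpm h

/-! ### Window operators of one Hermitian contraction -/

section Window

variable {ι : Type} [Fintype ι] [DecidableEq ι] {F : ℝ → ℝ} {Δ : ℝ} {X : Matrix ι ι ℂ}

/-- Simultaneous diagonal form of the window operators of a Hermitian contraction. -/
theorem Matrix.IsHermitian.exists_windowOp_eq (hX : X.IsHermitian) (hX1 : ‖X‖ ≤ 1) (F : ℝ → ℝ)
    (Δ : ℝ) :
    ∃ (φ : (ι → ℂ) →⋆ₐ[ℂ] Matrix ι ι ℂ) (t : ι → ℝ),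
      φ (fun a => (t a : ℂ)) = X ∧ (∀ a, |t a| ≤ 1) ∧
      ∀ m, windowOp F Δ X m = φ fun a => (√(F (t a / Δ - m)) : ℂ) := by
  obtain ⟨φ, t, hφ, hn⟩ := hX.exists_starAlgHom
  refine ⟨φ, t, hφ, fun a => ?_, fun m => ?_⟩
  · rw [← hφ, hn] at hX1
    simpa using (norm_le_pi_norm (fun a => (t a : ℂ)) a).trans hX1
  · rw [windowOp, ← hφ, cfc_starAlgHom_ofReal]

theorem windowOp_conjTranspose (m : ℤ) : (windowOp F Δ X m)ᴴ = windowOp F Δ X m :=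
  (cfc_predicate _ X : IsSelfAdjoint _)

/-- On an eigenvalue `x` the numbers `F (x / Δ - m)` form a probability distribution on the `m` with
`|x / Δ - m| < 1`, so the mean of `a` is as close to `x ^ p` as each such `a m`. The cases `p = 0,
1, 2` give the resolution of the identity and the two moments. -/
theorem sum_smul_windowOp_mul_self_sub_le (hF : IsWindow F) (hΔ : 0 < Δ) (hX : X.IsHermitian)
    (hX1 : ‖X‖ ≤ 1) (a : ℤ → ℝ) (p : ℕ) {c : ℝ} (hc : 0 ≤ c)
    (ha : ∀ (m : ℤ) (x : ℝ), |x| ≤ 1 → |x / Δ - m| < 1 → |a m - x ^ p| ≤ c) :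
    ‖∑ m : Finset.Icc (-⌈1 / Δ⌉) ⌈1 / Δ⌉,
      (a m : ℂ) • (windowOp F Δ X m * windowOp F Δ X m) - X ^ p‖ ≤ c := by
  obtain ⟨φ, t, hφ, ht, hw⟩ := hX.exists_windowOp_eq hX1 F Δ
  have h1 : ∑ m : Finset.Icc (-⌈1 / Δ⌉) ⌈1 / Δ⌉,
      (a m : ℂ) • (windowOp F Δ X m * windowOp F Δ X m) - X ^ p =
      φ (fun b => ((∑ m : Finset.Icc (-⌈1 / Δ⌉) ⌈1 / Δ⌉,
        a m * F (t b / Δ - (m : ℤ)) - t b ^ p : ℝ) : ℂ)) := by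
    simp_rw [hw, ← map_mul, ← map_smul, ← map_sum]
    rw [← hφ, ← map_pow, ← map_sub]
    congr 1
    ext b
    simp only [Pi.sub_apply, Finset.sum_apply, Pi.smul_apply, Pi.mul_apply, Pi.pow_apply,
      smul_eq_mul]
    push_cast
    congr 1
    refine Finset.sum_congr rfl fun m _ => ?_
    rw [← Complex.ofReal_mul, Real.mul_self_sqrt (hF.nonneg _)]
  rw [h1]
  refine (NonUnitalStarAlgHom.norm_apply_le φ _).trans
    ((pi_norm_le_iff_of_nonneg hc).2 fun b => ?_)
  rw [Complex.norm_real, Real.norm_eq_abs]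
  have hN : |t b / Δ| ≤ (⌈1 / Δ⌉ : ℤ) := by
    rw [abs_div, abs_of_pos hΔ]
    exact (div_le_div_of_nonneg_right (ht b) hΔ.le).trans (Int.le_ceil _)
  have hs := hF.sum_translates_eq_one hN
  have h2 : ∑ m : Finset.Icc (-⌈1 / Δ⌉) ⌈1 / Δ⌉, a m * F (t b / Δ - (m : ℤ)) - t b ^ p =
      ∑ m : Finset.Icc (-⌈1 / Δ⌉) ⌈1 / Δ⌉, (a m - t b ^ p) * F (t b / Δ - (m : ℤ)) := by
    simp_rw [sub_mul, Finset.sum_sub_distrib, ← Finset.mul_sum]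
    rw [hs, mul_one]
  have h3 : ∑ m : Finset.Icc (-⌈1 / Δ⌉) ⌈1 / Δ⌉, c * F (t b / Δ - (m : ℤ)) = c := by
    rw [← Finset.mul_sum, hs, mul_one]
  rw [h2]
  refine (Finset.abs_sum_le_sum_abs _ _).trans (le_of_le_of_eq ?_ h3)
  refine Finset.sum_le_sum fun m _ => ?_
  rw [abs_mul, abs_of_nonneg (hF.nonneg _)]
  by_cases h : |t b / Δ - (m : ℤ)| < 1
  · exact mul_le_mul_of_nonneg_right (ha m _ (ht b) h) (hF.nonneg _)
  · rw [hF.support _ (not_lt.1 h)]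
    simp

theorem sum_windowOp_mul_self (hF : IsWindow F) (hΔ : 0 < Δ) (hX : X.IsHermitian)
    (hX1 : ‖X‖ ≤ 1) :
    ∑ m : Finset.Icc (-⌈1 / Δ⌉) ⌈1 / Δ⌉, windowOp F Δ X m * windowOp F Δ X m = 1 := by
  have := sum_smul_windowOp_mul_self_sub_le hF hΔ hX hX1 (fun _ => 1) 0 le_rfl (by simp)
  simpa [sub_eq_zero] using this

/-- Averaging over the windows of `X` moves `Z` by at most a multiple of `‖[X, Z]‖ / Δ`. -/
theorem IsWindow.exists_norm_average_sub_le (hF : IsWindow F) :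
    ∃ K : ℝ, 0 < K ∧ ∀ (ι : Type) [Fintype ι] [DecidableEq ι] (Δ : ℝ) (X Z : Matrix ι ι ℂ),
      0 < Δ → X.IsHermitian → ‖X‖ ≤ 1 →
      ‖∑ m : Finset.Icc (-⌈1 / Δ⌉) ⌈1 / Δ⌉, windowOp F Δ X m * Z * windowOp F Δ X m - Z‖ ≤
        K / Δ * ‖X * Z - Z * X‖ := by
  obtain ⟨K, hK, hc⟩ := hF.exists_fourier_expansion
  refine ⟨2 * Real.pi * K * K, by positivity, fun ι _ _ Δ X Z hΔ hX hX1 => ?_⟩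
  obtain ⟨φ, t, hφ, ht, hw⟩ := hX.exists_windowOp_eq hX1 F Δ
  set N := ⌈1 / Δ⌉ with hN
  have hN0 : 0 < N := Int.ceil_pos.2 (by positivity)
  -- As many twists as windows: differences of indices are at most `2 * N`, so the characters
  -- separate them.
  obtain ⟨L, hL⟩ : ∃ L : ℕ, (L : ℤ) = 2 * N + 1 := ⟨(2 * N + 1).toNat, by omega⟩
  have hL0 : 0 < L := by omega
  let z : ℕ → Finset.Icc (-N) N → ℂ := fun j m =>
    Complex.exp (Complex.I * ((2 * Real.pi * (m : ℤ) * (j / L) : ℝ)))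
  have hz : ∀ m m', ∑ j ∈ Finset.range L, z j m * star (z j m') =
      if m = m' then (L : ℂ) else 0 := by
    intro m m'
    have h1 := Finset.mem_Icc.1 m.2
    have h2 := Finset.mem_Icc.1 m'.2
    have h3 : |(m : ℤ) - m'| < L := by rw [abs_lt]; omega
    simp only [z]
    rw [sum_exp_mul_star_exp hL0 h3]
    simp only [Subtype.ext_iff]
  have hrep := sub_eq_average_commutator (Finset.range L) (L := L) (z := z)
    (fun m => windowOp_conjTranspose (F := F) (Δ := Δ) (X := X) (m : ℤ))
    (sum_windowOp_mul_self hF hΔ hX hX1) hz Z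
  have hG : ∀ j ∈ Finset.range L,
      ‖∑ m, z j m • windowOp F Δ X m‖ ≤ K ∧
      ‖(∑ m, z j m • windowOp F Δ X m) * Z - Z * (∑ m, z j m • windowOp F Δ X m)‖ ≤
        2 * Real.pi / Δ * K * ‖X * Z - Z * X‖ := by
    intro j hj
    have hjL : (j : ℝ) / L ≤ 1 := by
      rw [div_le_one (by exact_mod_cast hL0)]
      exact_mod_cast (Finset.mem_range.1 hj).le
    obtain ⟨c, hcs, hcK, hcy⟩ := hc (j / L) (by positivity) hjL
    let g : ι → ℂ := fun a => ∑ m, z j m * (√(F (t a / Δ - (m : ℤ))) : ℂ)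
    have hGg : ∑ m, z j m • windowOp F Δ X m = φ g := by
      simp_rw [hw, ← map_smul, ← map_sum]
      congr 1
      ext a
      simp [g]
    -- The expansion is evaluated at `y = t a / Δ` with `θ = j / L`; this rescaling is the origin of
    -- the factor `1 / Δ`.
    let s : ℤ → ℝ := fun n => 2 * Real.pi / Δ * (n + j / L)
    have hg : ∀ a, HasSum (fun n => c n * Complex.exp (Complex.I * (s n * t a))) (g a) := by
      intro a
      have h1 := hcy (t a / Δ)
      have h2 : ∑' m : ℤ, Complex.exp (Complex.I * ((2 * Real.pi * m * (j / L) : ℝ))) *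
          (√(F (t a / Δ - m)) : ℂ) = g a := by
        rw [tsum_eq_sum (s := Finset.Icc (-N) N)]
        · exact (Finset.sum_coe_sort (Finset.Icc (-N) N) (fun m : ℤ =>
            Complex.exp (Complex.I * ((2 * Real.pi * m * (j / L) : ℝ))) *
              (√(F (t a / Δ - m)) : ℂ))).symm
        · intro m hm
          have hta : |t a / Δ| ≤ N := by
            rw [abs_div, abs_of_pos hΔ]
            exact (div_le_div_of_nonneg_right (ht a) hΔ.le).trans (Int.le_ceil _)
          obtain ⟨h3, h4⟩ := abs_le.1 hta
          have h5 : 1 ≤ |t a / Δ - m| := by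
            rw [Finset.mem_Icc, not_and_or, not_le, not_le] at hm
            rcases hm with h | h
            · have : (m : ℝ) + 1 ≤ -N := by exact_mod_cast h
              exact le_abs.2 (Or.inl (by linarith))
            · have : (N : ℝ) + 1 ≤ m := by exact_mod_cast h
              exact le_abs.2 (Or.inr (by linarith))
          rw [hF.support _ h5]
          simp
      rw [h2] at h1
      convert h1 using 5
      simp only [s]
      push_cast
      ring
    have hs1 : ∀ n, ‖c n‖ * |s n| ≤ 2 * Real.pi / Δ * (‖c n‖ * (1 + |n + (j / L : ℝ)|)) := by
      intro n
      simp only [s]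
      rw [abs_mul, abs_of_pos (by positivity : 0 < 2 * Real.pi / Δ), mul_left_comm]
      gcongr
      linarith
    have hs2 : Summable fun n => ‖c n‖ * |s n| :=
      Summable.of_nonneg_of_le (fun n => by positivity) hs1 (hcs.mul_left _)
    have hs3 : ∀ n, ‖c n‖ ≤ ‖c n‖ * (1 + |n + (j / L : ℝ)|) := fun n =>
      le_mul_of_one_le_right (norm_nonneg _) (by linarith [abs_nonneg (n + (j / L : ℝ))])
    have hs4 : Summable fun n => ‖c n‖ :=
      Summable.of_nonneg_of_le (fun n => norm_nonneg _) hs3 hcs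
    rw [hGg]
    constructor
    · exact (NonUnitalStarAlgHom.norm_apply_le φ _).trans
        (norm_le_of_hasSum_exp hs4 ((hs4.tsum_le_tsum hs3 hcs).trans hcK) hg)
    · rw [← hφ]
      refine norm_commutator_le_of_hasSum hs2 ?_ hg Z
      refine (hs2.tsum_le_tsum hs1 (hcs.mul_left _)).trans ?_
      rw [tsum_mul_left]
      gcongr
  have hnorm := congrArg norm hrep
  rw [norm_smul, Complex.norm_natCast] at hnorm
  have hbound : (L : ℝ) * ‖∑ m : Finset.Icc (-N) N, windowOp F Δ X m * Z * windowOp F Δ X m - Z‖ ≤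
      L * (2 * Real.pi / Δ * K * ‖X * Z - Z * X‖ * K) := by
    rw [hnorm, ← nsmul_eq_mul, ← Finset.card_range L, ← Finset.sum_const, Finset.card_range]
    refine norm_sum_le_of_le _ fun j hj => ?_
    obtain ⟨h1, h2⟩ := hG j hj
    exact l2_opNorm_mul_le_of_le h2 ((Matrix.l2_opNorm_conjTranspose _).trans_le h1)
  refine (le_of_mul_le_mul_left hbound (by exact_mod_cast hL0)).trans_eq ?_
  field_simp

end Window

/-! ### A concrete Naimark dilation -/

section Dilation

variable {α ι κ μ : Type*} [Fintype α] [DecidableEq α] [Fintype ι] [DecidableEq ι]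
  [Fintype κ] [DecidableEq κ] [Fintype μ] [DecidableEq μ]

/-- The matrices `(A k)ᴴ` stacked into one column. -/
def blockColumn (A : α → Matrix ι ι ℂ) : Matrix (ι × α) ι ℂ :=
  Matrix.of fun p b => (A p.2)ᴴ p.1 b

theorem blockColumn_conj_blockDiagonal (A D : α → Matrix ι ι ℂ) :
    (blockColumn A)ᴴ * Matrix.blockDiagonal D * blockColumn A = ∑ k, A k * D k * (A k)ᴴ := by
  ext a b
  simp only [Matrix.mul_apply, Matrix.sum_apply, Fintype.sum_prod_type_right, blockColumn,
    Matrix.blockDiagonal_apply, Matrix.of_apply, Matrix.conjTranspose_apply, star_star, mul_ite,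
    mul_zero, Finset.sum_ite_irrel, Finset.sum_const_zero, Finset.sum_ite_eq', Finset.mem_univ,
    if_true]

theorem l2_opNorm_blockDiagonal_le {D : α → Matrix ι ι ℂ} {c : ℝ} (hc : 0 ≤ c)
    (hD : ∀ k, ‖D k‖ ≤ c) : ‖Matrix.blockDiagonal D‖ ≤ c := by
  refine l2_opNorm_le_of_forall_mulVec hc fun x => ?_
  have h : ∀ i k, (Matrix.blockDiagonal D *ᵥ x) (i, k) = (D k *ᵥ fun j => x (j, k)) i := by
    intro i k
    simp [Matrix.mulVec, dotProduct, Matrix.blockDiagonal_apply, Fintype.sum_prod_type]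
  simp only [Fintype.sum_prod_type_right, h, Finset.mul_sum (s := (Finset.univ : Finset α))]
  refine Finset.sum_le_sum fun k _ => (sum_norm_mulVec_sq_le (D k) _).trans ?_
  have := hD k
  gcongr

theorem blockColumn_isometry {A : α → Matrix ι ι ℂ} (hA : ∑ k, A k * (A k)ᴴ = 1) :
    (blockColumn A)ᴴ * blockColumn A = 1 := by
  have h := blockColumn_conj_blockDiagonal A 1
  rw [Matrix.blockDiagonal_one, Matrix.mul_one] at h
  simpa [hA] using h

/-- A unital completely positive map is a contraction: it is the compression of a block diagonal
matrix by the isometry `blockColumn A`. -/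
theorem norm_sum_conj_le {A : α → Matrix ι ι ℂ} (hA : ∑ k, A k * (A k)ᴴ = 1)
    (B : Matrix ι ι ℂ) : ‖∑ k, A k * B * (A k)ᴴ‖ ≤ ‖B‖ := by
  rw [← blockColumn_conj_blockDiagonal A fun _ => B]
  exact (l2_opNorm_conj_isometry_le (blockColumn_isometry hA) _).trans
    (l2_opNorm_blockDiagonal_le (norm_nonneg _) fun _ => le_rfl)

theorem isNaimark_blockColumn {A : α → Matrix ι ι ℂ} (hA : ∑ k, A k * (A k)ᴴ = 1) :
    IsNaimark (fun k => A k * (A k)ᴴ) (blockColumn A)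
      (fun k => Matrix.blockDiagonal (Pi.single k (1 : Matrix ι ι ℂ))) where
  isometry := blockColumn_isometry hA
  projector k := by
    constructor
    · rw [IsIdempotentElem, ← Matrix.blockDiagonal_mul]
      congr 1
      ext1 l
      rcases eq_or_ne l k with rfl | h <;> simp [*]
    · rw [IsSelfAdjoint, Matrix.star_eq_conjTranspose, Matrix.blockDiagonal_conjTranspose]
      congr 1
      ext1 l
      rcases eq_or_ne l k with rfl | h <;> simp [*]
  orthogonal k l h := by
    rw [← Matrix.blockDiagonal_mul, ← Matrix.blockDiagonal_zero]
    congr 1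
    ext1 j
    rcases eq_or_ne j k with rfl | hj
    · simp [h]
    · simp [hj]
  complete := by
    rw [← Matrix.blockDiagonal_one, ← Finset.univ_sum_single (1 : α → Matrix ι ι ℂ)]
    exact (map_sum (Matrix.blockDiagonalAddMonoidHom ι ι α ℂ) _ _).symm
  compress k := by
    rw [blockColumn_conj_blockDiagonal, Finset.sum_eq_single k]
    · simp
    · intro l _ hl
      simp [hl]
    · simp

theorem IsNaimark.submatrix {E : α → Matrix ι ι ℂ} {W : Matrix κ ι ℂ} {Q : α → Matrix κ κ ℂ}
    (h : IsNaimark E W Q) (e : μ ≃ κ) :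
    IsNaimark E (W.submatrix e id) (fun k => (Q k).submatrix e e) where
  isometry := by
    rw [Matrix.conjTranspose_submatrix, Matrix.submatrix_mul_equiv, h.isometry,
      Matrix.submatrix_id_id]
  projector k := by
    constructor
    · rw [IsIdempotentElem, Matrix.submatrix_mul_equiv, (h.projector k).isIdempotentElem]
    · rw [IsSelfAdjoint, Matrix.star_eq_conjTranspose, Matrix.conjTranspose_submatrix,
        ← Matrix.star_eq_conjTranspose, (h.projector k).isSelfAdjoint.star_eq]
  orthogonal k l hkl := by
    rw [Matrix.submatrix_mul_equiv, h.orthogonal k l hkl, Matrix.submatrix_zero]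
    rfl
  complete := by
    have : ∑ k, (Q k).submatrix e e = (∑ k, Q k).submatrix e e := by
      ext a b
      simp [Matrix.sum_apply]
    rw [this, h.complete, Matrix.submatrix_one_equiv]
  compress k := by
    rw [Matrix.conjTranspose_submatrix, Matrix.submatrix_mul_equiv, Matrix.submatrix_mul_equiv,
      h.compress, Matrix.submatrix_id_id]

end Dilation

/-! ### Averages over ordered products -/

section IteratedAverage

variable {α ι : Type*} [Fintype α] [DecidableEq α] [Fintype ι] [DecidableEq ι]

/-- The ordered product `w 0 (k 0) * ⋯ * w (d-1) (k (d-1))`. -/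
def orderedProd {d : ℕ} (w : Fin d → α → Matrix ι ι ℂ) (k : Fin d → α) : Matrix ι ι ℂ :=
  (List.ofFn fun i => w i (k i)).prod

theorem orderedProd_cons {d : ℕ} (w : Fin (d + 1) → α → Matrix ι ι ℂ) (m : α) (k : Fin d → α) :
    orderedProd w (Fin.cons m k : Fin (d + 1) → α) =
      w 0 m * orderedProd (fun i => w i.succ) k := by
  simp [orderedProd, List.ofFn_succ]

theorem sum_fin_succ_function {M : Type*} [AddCommMonoid M] {d : ℕ}
    (f : (Fin (d + 1) → α) → M) :
    ∑ k, f k = ∑ m, ∑ k : Fin d → α, f (Fin.cons m k : Fin (d + 1) → α) := by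
  rw [← Fintype.sum_prod_type' (f := fun m (k : Fin d → α) => f (Fin.cons m k : Fin (d + 1) → α))]
  exact (Fintype.sum_equiv (Fin.consEquiv fun _ => α) _ _ fun p => rfl).symm

/-- Conjugation by ordered products is a composition of `d` averages. Each is a contraction and
displaces `G` by at most `c`, so the errors add instead of multiplying. -/
theorem norm_sum_orderedProd_conj_sub_le {d : ℕ} {w : Fin d → α → Matrix ι ι ℂ}
    (hw : ∀ i, ∑ m, w i m * (w i m)ᴴ = 1) {G : Matrix ι ι ℂ} {c : ℝ}
    (hG : ∀ i, ‖∑ m, w i m * G * (w i m)ᴴ - G‖ ≤ c) (H : Matrix ι ι ℂ) :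
    ‖∑ k, orderedProd w k * H * (orderedProd w k)ᴴ - G‖ ≤ ‖H - G‖ + d * c := by
  induction d with
  | zero => simp [orderedProd]
  | succ d ih =>
    have ih' := ih (fun i => hw i.succ) (fun i => hG i.succ)
    set Ψ := ∑ k, orderedProd (fun i => w (Fin.succ i)) k * H *
      (orderedProd (fun i => w (Fin.succ i)) k)ᴴ with hΨ
    have h1 : ∑ k, orderedProd w k * H * (orderedProd w k)ᴴ - G =
        ∑ m, w 0 m * (Ψ - G) * (w 0 m)ᴴ + (∑ m, w 0 m * G * (w 0 m)ᴴ - G) := by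
      rw [sum_fin_succ_function]
      simp_rw [orderedProd_cons, mul_sub, sub_mul, Finset.sum_sub_distrib, hΨ, Finset.mul_sum,
        Finset.sum_mul, Matrix.conjTranspose_mul, mul_assoc]
      abel
    rw [h1]
    refine (norm_add_le _ _).trans ?_
    have h2 := norm_sum_conj_le (hw 0) (Ψ - G)
    have h3 := hG 0
    push_cast
    linarith

theorem sum_orderedProd_mul_conjTranspose {d : ℕ} {w : Fin d → α → Matrix ι ι ℂ}
    (hw : ∀ i, ∑ m, w i m * (w i m)ᴴ = 1) :
    ∑ k, orderedProd w k * (orderedProd w k)ᴴ = 1 := by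
  have h := norm_sum_orderedProd_conj_sub_le hw (G := 1) (c := 0)
    (fun i => by simp [hw i]) 1
  simpa [sub_eq_zero] using h

/-- In `orderedProd w k * (orderedProd w k)ᴴ` the last factors are innermost. Those after `i` sum to
the identity, the factor `i` produces `G` up to `b`, and each factor before `i` averages at cost
`c`. -/
theorem norm_sum_smul_orderedProd_sub_le {d : ℕ} {w : Fin d → α → Matrix ι ι ℂ}
    (hw : ∀ i, ∑ m, w i m * (w i m)ᴴ = 1) {G : Matrix ι ι ℂ} {b c : ℝ} (a : α → ℂ) (i : Fin d)
    (hG : ∀ i, ‖∑ m, w i m * G * (w i m)ᴴ - G‖ ≤ c)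
    (ha : ‖∑ m, a m • (w i m * (w i m)ᴴ) - G‖ ≤ b) :
    ‖∑ k : Fin d → α, a (k i) • (orderedProd w k * (orderedProd w k)ᴴ) - G‖ ≤ b + d * c := by
  induction d with
  | zero => exact i.elim0
  | succ d ih =>
    have hc : 0 ≤ c := (norm_nonneg _).trans (hG 0)
    refine Fin.cases (fun ha => ?_) (fun i ha => ?_) i ha
    · have h1 : ∑ k : Fin (d + 1) → α, a (k 0) • (orderedProd w k * (orderedProd w k)ᴴ) =
          ∑ m, a m • (w 0 m * (w 0 m)ᴴ) := by
        rw [sum_fin_succ_function]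
        refine Finset.sum_congr rfl fun m _ => ?_
        simp only [Fin.cons_zero, orderedProd_cons, ← Finset.smul_sum, Matrix.conjTranspose_mul]
        have := sum_orderedProd_mul_conjTranspose (fun i => hw (Fin.succ i))
        have h2 : ∑ k, w 0 m * orderedProd (fun i => w (Fin.succ i)) k *
            ((orderedProd (fun i => w (Fin.succ i)) k)ᴴ * (w 0 m)ᴴ) = w 0 m *
            (∑ k, orderedProd (fun i => w (Fin.succ i)) k *
              (orderedProd (fun i => w (Fin.succ i)) k)ᴴ) * (w 0 m)ᴴ := by
          simp_rw [Finset.mul_sum, Finset.sum_mul, mul_assoc]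
        rw [h2, this, mul_one]
      rw [h1]
      have : 0 ≤ ((d + 1 : ℕ) : ℝ) * c := by positivity
      linarith
    · have ih' := ih (fun i => hw i.succ) i (fun i => hG i.succ) ha
      set Ψ := ∑ k : Fin d → α, a (k i) • (orderedProd (fun i => w (Fin.succ i)) k *
        (orderedProd (fun i => w (Fin.succ i)) k)ᴴ) with hΨ
      have h1 : ∑ k : Fin (d + 1) → α, a (k i.succ) • (orderedProd w k * (orderedProd w k)ᴴ) - G =
          ∑ m, w 0 m * (Ψ - G) * (w 0 m)ᴴ + (∑ m, w 0 m * G * (w 0 m)ᴴ - G) := by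
        rw [sum_fin_succ_function]
        simp_rw [orderedProd_cons, Fin.cons_succ, mul_sub, sub_mul, Finset.sum_sub_distrib, hΨ,
          Finset.mul_sum, Finset.sum_mul, Matrix.conjTranspose_mul, Matrix.mul_smul,
          Matrix.smul_mul, mul_assoc]
        abel
      rw [h1]
      refine (norm_add_le _ _).trans ?_
      have h2 := norm_sum_conj_le (hw 0) (Ψ - G)
      have h3 := hG 0
      push_cast
      linarith

variable {d : ℕ} {w v : Fin d → α → Matrix ι ι ℂ} {G : Matrix ι ι ℂ} {b c : ℝ}

theorem sum_prod_orderedProd_mul_conjTranspose (hv : ∀ i, ∑ m, v i m * (v i m)ᴴ = 1)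
    (a : (Fin d → α) → ℂ) :
    ∑ p : (Fin d → α) × (Fin d → α), a p.1 • ((orderedProd w p.1 * orderedProd v p.2) *
      (orderedProd w p.1 * orderedProd v p.2)ᴴ) =
      ∑ k, a k • (orderedProd w k * (orderedProd w k)ᴴ) := by
  rw [Fintype.sum_prod_type]
  refine Finset.sum_congr rfl fun k _ => ?_
  dsimp only
  rw [← Finset.smul_sum]
  have h := sum_orderedProd_mul_conjTranspose hv
  simp_rw [Matrix.conjTranspose_mul, mul_assoc, ← Finset.mul_sum]
  simp_rw [← mul_assoc (orderedProd v _), ← Finset.sum_mul, h, one_mul]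

/-- The `v`-factors are innermost, so their moment is afterwards averaged over all of `w`; hence the
second `d * c`. -/
theorem norm_sum_smul_snd_orderedProd_sub_le (hw : ∀ i, ∑ m, w i m * (w i m)ᴴ = 1)
    (hv : ∀ i, ∑ m, v i m * (v i m)ᴴ = 1) (a : α → ℂ) (i : Fin d)
    (hwG : ∀ i, ‖∑ m, w i m * G * (w i m)ᴴ - G‖ ≤ c)
    (hvG : ∀ i, ‖∑ m, v i m * G * (v i m)ᴴ - G‖ ≤ c)
    (ha : ‖∑ m, a m • (v i m * (v i m)ᴴ) - G‖ ≤ b) :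
    ‖∑ p : (Fin d → α) × (Fin d → α), a (p.2 i) • ((orderedProd w p.1 * orderedProd v p.2) *
      (orderedProd w p.1 * orderedProd v p.2)ᴴ) - G‖ ≤ b + 2 * (d * c) := by
  have h1 : ∑ p : (Fin d → α) × (Fin d → α), a (p.2 i) •
      ((orderedProd w p.1 * orderedProd v p.2) * (orderedProd w p.1 * orderedProd v p.2)ᴴ) =
      ∑ k, orderedProd w k * (∑ l, a (l i) • (orderedProd v l * (orderedProd v l)ᴴ)) *
        (orderedProd w k)ᴴ := by
    rw [Fintype.sum_prod_type]
    refine Finset.sum_congr rfl fun k _ => ?_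
    simp_rw [Matrix.conjTranspose_mul, Finset.mul_sum, Finset.sum_mul, Matrix.mul_smul,
      Matrix.smul_mul, mul_assoc]
  rw [h1]
  refine (norm_sum_orderedProd_conj_sub_le hw hwG _).trans ?_
  linarith [norm_sum_smul_orderedProd_sub_le hv a i hvG ha]

theorem norm_sum_smul_fst_orderedProd_sub_le (hw : ∀ i, ∑ m, w i m * (w i m)ᴴ = 1)
    (hv : ∀ i, ∑ m, v i m * (v i m)ᴴ = 1) (a : α → ℂ) (i : Fin d)
    (hwG : ∀ i, ‖∑ m, w i m * G * (w i m)ᴴ - G‖ ≤ c)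
    (ha : ‖∑ m, a m • (w i m * (w i m)ᴴ) - G‖ ≤ b) :
    ‖∑ p : (Fin d → α) × (Fin d → α), a (p.1 i) • ((orderedProd w p.1 * orderedProd v p.2) *
      (orderedProd w p.1 * orderedProd v p.2)ᴴ) - G‖ ≤ b + 2 * (d * c) := by
  rw [sum_prod_orderedProd_mul_conjTranspose hv fun k => a (k i)]
  refine (norm_sum_smul_orderedProd_sub_le hw a i hwG ha).trans ?_
  have : 0 ≤ d * c := mul_nonneg (Nat.cast_nonneg _) ((norm_nonneg _).trans (hwG i))
  linarith

theorem sum_pair_orderedProd_mul_conjTranspose (hw : ∀ i, ∑ m, w i m * (w i m)ᴴ = 1)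
    (hv : ∀ i, ∑ m, v i m * (v i m)ᴴ = 1) :
    ∑ p : (Fin d → α) × (Fin d → α), (orderedProd w p.1 * orderedProd v p.2) *
      (orderedProd w p.1 * orderedProd v p.2)ᴴ = 1 := by
  have h := sum_prod_orderedProd_mul_conjTranspose (w := w) hv fun _ => 1
  simp_rw [one_smul] at h
  rw [h, sum_orderedProd_mul_conjTranspose hw]

end IteratedAverage

/-! ### Phases of dilated normal matrices -/

/-- The phase of a complex number, with a prescribed value at `0`. -/
def phaseOr (z v : ℂ) : ℂ := if v = 0 then z else v / ‖v‖

theorem norm_phaseOr {z : ℂ} (hz : ‖z‖ = 1) (v : ℂ) : ‖phaseOr z v‖ = 1 := by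
  unfold phaseOr
  split_ifs with h
  · exact hz
  · rw [norm_div, Complex.norm_real, norm_norm, div_self (norm_ne_zero_iff.2 h)]

theorem star_phaseOr (z v : ℂ) : star (phaseOr z v) = phaseOr (star z) (star v) := by
  unfold phaseOr
  by_cases h : v = 0 <;> simp [h]

/-- The left side is `|1 - ‖v‖|`. The weaker bound by `1 - ‖v‖ ^ 2` is preferred because it is a
polynomial in `v` and its conjugate, hence accessible through the second moment. -/
theorem norm_phaseOr_sub_le {z : ℂ} (hz : ‖z‖ = 1) (v : ℂ) :
    ‖phaseOr z v - v‖ ≤ |1 - ‖v‖ ^ 2| := by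
  unfold phaseOr
  split_ifs with h
  · simp [h, hz]
  · have h0 : (‖v‖ : ℂ) ≠ 0 := by simpa using h
    have h1 : v / ‖v‖ - v = (v / ‖v‖) * ((1 - ‖v‖ : ℝ) : ℂ) := by
      push_cast
      field_simp
    rw [h1, norm_mul, norm_div, Complex.norm_real, norm_norm, div_self (norm_ne_zero_iff.2 h),
      one_mul, Complex.norm_real, Real.norm_eq_abs,
      show 1 - ‖v‖ ^ 2 = (1 - ‖v‖) * (1 + ‖v‖) by ring, abs_mul]
    refine le_mul_of_one_le_right (abs_nonneg _) (le_abs.2 (Or.inl ?_))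
    linarith [norm_nonneg v]

theorem mul_normSq_rpow_neg_half (v : ℂ) :
    v * (((‖v‖ ^ 2 : ℝ) ^ (-(1 / 2) : ℝ) : ℝ) : ℂ) = v / ‖v‖ := by
  have : (‖v‖ ^ 2 : ℝ) ^ (-(1 / 2) : ℝ) = ‖v‖⁻¹ := by
    rw [← Real.rpow_natCast, ← Real.rpow_mul (norm_nonneg v)]
    norm_num
    exact Real.rpow_neg_one _
  rw [this, Complex.ofReal_inv, div_eq_mul_inv]

section Phase

variable {α ι κ : Type*} [Fintype α] [Fintype ι] [DecidableEq ι] [Fintype κ] [DecidableEq κ]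

theorem conjTranspose_starAlgHom (φ : (α → ℂ) →⋆ₐ[ℂ] Matrix κ κ ℂ) (v : α → ℂ) :
    (φ v)ᴴ = φ (star v) :=
  (map_star φ v).symm

theorem polar_starAlgHom (φ : (α → ℂ) →⋆ₐ[ℂ] Matrix κ κ ℂ) (v : α → ℂ) :
    polar (φ v) = φ fun k => v k / ‖v k‖ := by
  have h1 : (φ v)ᴴ * φ v = φ fun k => ((‖v k‖ ^ 2 : ℝ) : ℂ) := by
    rw [conjTranspose_starAlgHom, ← map_mul]
    congr 1
    ext k
    simp [Complex.conj_mul']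
  rw [polar, h1, cfc_starAlgHom_ofReal, ← map_mul]
  congr 1
  ext k
  exact mul_normSq_rpow_neg_half (v k)

theorem continuous_starAlgHom_pi (φ : (α → ℂ) →⋆ₐ[ℂ] Matrix κ κ ℂ) : Continuous φ :=
  (LinearMap.toContinuousLinearMap (φ : (α → ℂ) →ₗ[ℂ] Matrix κ κ ℂ)).continuous

theorem starAlgHom_add_smul_one (φ : (α → ℂ) →⋆ₐ[ℂ] Matrix κ κ ℂ) (v : α → ℂ) (c : ℂ) :
    φ v + c • 1 = φ fun k => v k + c := by
  rw [← map_one φ, ← map_smul, ← map_add]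
  congr 1
  ext k
  simp

theorem tendsto_polar_starAlgHom (φ : (α → ℂ) →⋆ₐ[ℂ] Matrix κ κ ℂ) (v : α → ℂ) {z : ℂ}
    (hz : ‖z‖ = 1) :
    Tendsto (fun x : ℝ => polar (φ v + ((x : ℂ) * z) • 1)) (𝓝[>] 0)
      (𝓝 (φ fun k => phaseOr z (v k))) := by
  simp_rw [starAlgHom_add_smul_one, polar_starAlgHom]
  refine ((continuous_starAlgHom_pi φ).tendsto _).comp (tendsto_pi_nhds.2 fun k => ?_)
  unfold phaseOr
  split_ifs with h
  · refine tendsto_const_nhds.congr' ?_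
    filter_upwards [self_mem_nhdsWithin] with x hx
    have hx0 : (0 : ℝ) < x := hx
    have hxc : (x : ℂ) ≠ 0 := by exact_mod_cast hx0.ne'
    rw [h, zero_add, norm_mul, hz, mul_one, Complex.norm_real, Real.norm_eq_abs,
      abs_of_pos hx0]
    field_simp
  · have hc : ContinuousAt (fun x : ℝ => (v k + x * z) / (‖v k + x * z‖ : ℂ)) 0 := by
      refine ContinuousAt.div (by fun_prop) (by fun_prop) ?_
      simpa using h
    have := hc.tendsto.mono_left (nhdsWithin_le_nhds (s := Set.Ioi 0))
    simpa using this

variable {φ : (α → ℂ) →⋆ₐ[ℂ] Matrix κ κ ℂ} {v : α → ℂ} {W : Matrix κ ι ℂ} {T : Matrix ι ι ℂ}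
  {a b : ℝ}

/-- A variance estimate: expanding the square of `V * W - W * T` leaves only the errors of the first
and second compressed moments, because `T` is unitary. -/
theorem norm_mul_isometry_sub_sq_le {V : Matrix κ κ ℂ} (hW : Wᴴ * W = 1)
    (hT : T ∈ Matrix.unitaryGroup ι ℂ)
    (ha : ‖Wᴴ * V * W - T‖ ≤ a) (hb : ‖Wᴴ * (Vᴴ * V) * W - 1‖ ≤ b) :
    ‖V * W - W * T‖ ≤ √(b + 2 * a) := by
  have hT1 : Tᴴ * T = 1 := Matrix.mem_unitaryGroup_iff'.1 hT
  have hTn := l2_opNorm_le_one_of_isometry hT1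
  have hTn' : ‖Tᴴ‖ ≤ 1 := by rwa [Matrix.l2_opNorm_conjTranspose]
  have h1 : (V * W - W * T)ᴴ * (V * W - W * T) =
      (Wᴴ * (Vᴴ * V) * W - 1) - (Wᴴ * V * W - T)ᴴ * T - Tᴴ * (Wᴴ * V * W - T) := by
    have h2 : Tᴴ * Wᴴ * (W * T) = 1 := by
      rw [Matrix.mul_assoc, ← Matrix.mul_assoc Wᴴ, hW, Matrix.one_mul, hT1]
    simp only [Matrix.conjTranspose_sub, Matrix.conjTranspose_mul, Matrix.sub_mul, Matrix.mul_sub,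
      Matrix.conjTranspose_conjTranspose, hT1, h2]
    simp only [Matrix.mul_assoc]
    abel
  have h3 := Matrix.l2_opNorm_conjTranspose_mul_self (V * W - W * T)
  rw [h1] at h3
  have ha' : ‖(Wᴴ * V * W - T)ᴴ‖ ≤ a := (Matrix.l2_opNorm_conjTranspose _).trans_le ha
  have h4 := l2_opNorm_mul_le_of_le ha' hTn
  have h5 := l2_opNorm_mul_le_of_le hTn' ha
  refine Real.le_sqrt_of_sq_le ?_
  rw [sq, ← h3]
  refine (norm_sub_le _ _).trans ?_
  linarith [norm_sub_le (Wᴴ * (Vᴴ * V) * W - 1) ((Wᴴ * V * W - T)ᴴ * T)]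

/-- The phase equals `v + r * (1 - |v| ^ 2)` with `|r| ≤ 1`. On the range of `W` the matrix of `1 -
|v| ^ 2` is at most `(R + 1) * δ`, by applying the variance estimate to `v` and to its conjugate;
the term `v` adds one more `δ`. -/
theorem norm_phase_mul_isometry_sub_le {z : ℂ} (hz : ‖z‖ = 1) (hW : Wᴴ * W = 1)
    (hT : T ∈ Matrix.unitaryGroup ι ℂ) {R : ℝ} (hv : ∀ k, ‖v k‖ ≤ R) (hR : 0 ≤ R)
    (ha : ‖Wᴴ * φ v * W - T‖ ≤ a) (hb : ‖Wᴴ * φ (star v * v) * W - 1‖ ≤ b) :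
    ‖φ (fun k => phaseOr z (v k)) * W - W * T‖ ≤ (R + 2) * √(b + 2 * a) := by
  have hT1 : Tᴴ * T = 1 := Matrix.mem_unitaryGroup_iff'.1 hT
  set δ := √(b + 2 * a)
  have h1 : ‖φ v * W - W * T‖ ≤ δ := by
    refine norm_mul_isometry_sub_sq_le hW hT ha ?_
    rwa [conjTranspose_starAlgHom, ← map_mul]
  have h2 : ‖φ (star v) * W - W * Tᴴ‖ ≤ δ := by
    refine norm_mul_isometry_sub_sq_le hW (Unitary.star_mem hT) ?_ ?_
    · have h3 : Wᴴ * φ (star v) * W - Tᴴ = (Wᴴ * φ v * W - T)ᴴ := by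
        rw [Matrix.conjTranspose_sub, Matrix.conjTranspose_mul, Matrix.conjTranspose_mul,
          conjTranspose_starAlgHom, Matrix.conjTranspose_conjTranspose, ← Matrix.mul_assoc]
      rw [h3]
      exact (Matrix.l2_opNorm_conjTranspose _).trans_le ha
    · rwa [conjTranspose_starAlgHom, ← map_mul, star_star, mul_comm]
  have hvn : ‖φ (star v)‖ ≤ R :=
    (NonUnitalStarAlgHom.norm_apply_le φ _).trans
      ((pi_norm_le_iff_of_nonneg hR).2 fun k => by simpa using hv k)
  have h3 : ‖φ (1 - star v * v) * W‖ ≤ R * δ + δ * 1 := by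
    have : φ (1 - star v * v) * W =
        -(φ (star v) * (φ v * W - W * T) + (φ (star v) * W - W * Tᴴ) * T) := by
      rw [map_sub, map_one, map_mul, Matrix.sub_mul, Matrix.sub_mul, Matrix.mul_sub,
        Matrix.mul_assoc W, hT1]
      simp only [Matrix.mul_assoc, Matrix.one_mul, Matrix.mul_one]
      abel
    rw [this, norm_neg]
    exact (norm_add_le _ _).trans (add_le_add (l2_opNorm_mul_le_of_le hvn h1)
      (l2_opNorm_mul_le_of_le h2 (l2_opNorm_le_one_of_isometry hT1)))
  -- Where `|v k| = 1` the quotient is `0` by the convention for division, which is right because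
  -- the numerator vanishes too.
  let r : α → ℂ := fun k => (phaseOr z (v k) - v k) / (1 - star (v k) * v k)
  have hvv : ∀ k, 1 - star (v k) * v k = ((1 - ‖v k‖ ^ 2 : ℝ) : ℂ) := by
    intro k
    rw [Complex.star_def, Complex.conj_mul']
    push_cast
    rfl
  have hr : ‖φ r‖ ≤ 1 := by
    refine (NonUnitalStarAlgHom.norm_apply_le φ _).trans
      ((pi_norm_le_iff_of_nonneg zero_le_one).2 fun k => ?_)
    simp only [r]
    rw [hvv, norm_div, Complex.norm_real, Real.norm_eq_abs]
    exact div_le_one_of_le₀ (norm_phaseOr_sub_le hz _) (abs_nonneg _)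
  have h4 : φ (fun k => phaseOr z (v k)) = φ r * φ (1 - star v * v) + φ v := by
    rw [← map_mul, ← map_add]
    congr 1
    ext k
    simp only [r, Pi.add_apply, Pi.mul_apply, Pi.sub_apply, Pi.one_apply, Pi.star_apply]
    by_cases h0 : 1 - star (v k) * v k = 0
    · have h5 := norm_phaseOr_sub_le hz (v k)
      rw [hvv] at h0
      rw [Complex.ofReal_eq_zero.1 h0, abs_zero, norm_le_zero_iff, sub_eq_zero] at h5
      rw [hvv, h0, mul_zero, zero_add, h5]
    · rw [div_mul_cancel₀ _ h0, sub_add_cancel]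
  have h6 : φ (fun k => phaseOr z (v k)) * W - W * T =
      φ r * (φ (1 - star v * v) * W) + (φ v * W - W * T) := by
    rw [h4, Matrix.add_mul, Matrix.mul_assoc]
    abel
  rw [h6]
  have h7 := l2_opNorm_mul_le_of_le hr h3
  refine (norm_add_le _ _).trans ?_
  linarith

theorem norm_conjTranspose_phase_mul_isometry_sub_le {z : ℂ} (hz : ‖z‖ = 1) (hW : Wᴴ * W = 1)
    (hT : T ∈ Matrix.unitaryGroup ι ℂ) {R : ℝ} (hv : ∀ k, ‖v k‖ ≤ R) (hR : 0 ≤ R)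
    (ha : ‖Wᴴ * φ v * W - T‖ ≤ a) (hb : ‖Wᴴ * φ (star v * v) * W - 1‖ ≤ b) :
    ‖(φ (fun k => phaseOr z (v k)))ᴴ * W - W * Tᴴ‖ ≤ (R + 2) * √(b + 2 * a) := by
  have h1 : star (fun k => phaseOr z (v k)) = fun k => phaseOr (star z) (star v k) := by
    ext k
    exact star_phaseOr z (v k)
  rw [conjTranspose_starAlgHom, h1]
  refine norm_phase_mul_isometry_sub_le (v := star v) (by simpa using hz) hW
    (Unitary.star_mem hT) (fun k => by simpa using hv k) hR ?_ ?_
  · have h3 : Wᴴ * φ (star v) * W - star T = (Wᴴ * φ v * W - T)ᴴ := by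
      rw [Matrix.conjTranspose_sub, Matrix.conjTranspose_mul, Matrix.conjTranspose_mul,
        conjTranspose_starAlgHom, Matrix.conjTranspose_conjTranspose, ← Matrix.mul_assoc,
        Matrix.star_eq_conjTranspose]
    rw [h3]
    exact (Matrix.l2_opNorm_conjTranspose _).trans_le ha
  · rwa [star_star, mul_comm]

theorem norm_commutator_projector_le {U : Matrix κ κ ℂ} (hW : Wᴴ * W = 1) {η : ℝ}
    (h1 : ‖U * W - W * T‖ ≤ η) (h2 : ‖Uᴴ * W - W * Tᴴ‖ ≤ η) :
    ‖W * Wᴴ * U - U * (W * Wᴴ)‖ ≤ 2 * η := by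
  have h3 : W * Wᴴ * U - U * (W * Wᴴ) =
      W * (Uᴴ * W - W * Tᴴ)ᴴ - (U * W - W * T) * Wᴴ := by
    simp only [Matrix.conjTranspose_sub, Matrix.conjTranspose_mul,
      Matrix.conjTranspose_conjTranspose, Matrix.mul_sub, Matrix.sub_mul, Matrix.mul_assoc]
    abel
  have hWn := l2_opNorm_le_one_of_isometry hW
  have hWn' : ‖Wᴴ‖ ≤ 1 := by rwa [Matrix.l2_opNorm_conjTranspose]
  have h2' : ‖(Uᴴ * W - W * Tᴴ)ᴴ‖ ≤ η := (Matrix.l2_opNorm_conjTranspose _).trans_le h2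
  rw [h3]
  refine (norm_sub_le _ _).trans ?_
  linarith [l2_opNorm_mul_le_of_le hWn h2', l2_opNorm_mul_le_of_le h1 hWn']

end Phase

/-! ### Hermitian and skew parts of unitaries -/

section CartesianParts

variable {ι : Type*} [Fintype ι] [DecidableEq ι] {U V : Matrix ι ι ℂ}

theorem rePart_isHermitian (U : Matrix ι ι ℂ) : (rePart U).IsHermitian := by
  simp [Matrix.IsHermitian, rePart, Matrix.conjTranspose_smul, add_comm]

theorem imPart_isHermitian (U : Matrix ι ι ℂ) : (imPart U).IsHermitian := by
  simp only [Matrix.IsHermitian, imPart, Matrix.conjTranspose_smul, Matrix.conjTranspose_sub,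
    Matrix.conjTranspose_conjTranspose]
  rw [← neg_sub, smul_neg, ← neg_smul]
  congr 1
  simp

theorem rePart_add_imPart (U : Matrix ι ι ℂ) : rePart U + Complex.I • imPart U = U := by
  have : Complex.I * (2 * Complex.I)⁻¹ = 2⁻¹ := by
    field_simp
  rw [rePart, imPart, smul_smul, this, ← smul_add]
  have h : U + Uᴴ + (U - Uᴴ) = (2 : ℂ) • U := by rw [two_smul]; abel
  rw [h, smul_smul]
  norm_num

theorem rePart_sq_add_imPart_sq (hU : U ∈ Matrix.unitaryGroup ι ℂ) :
    rePart U ^ 2 + imPart U ^ 2 = 1 := by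
  have h1 : U * Uᴴ = 1 := Matrix.mem_unitaryGroup_iff.1 hU
  have h2 : Uᴴ * U = 1 := Matrix.mem_unitaryGroup_iff'.1 hU
  have h3 : ((2 * Complex.I)⁻¹ : ℂ) ^ 2 = -((2 : ℂ)⁻¹ ^ 2) := by
    rw [mul_inv, mul_pow, Complex.inv_I, neg_sq, Complex.I_sq]
    ring
  rw [rePart, imPart, smul_pow, smul_pow, h3, neg_smul, ← sub_eq_add_neg, ← smul_sub]
  have h4 : (U + Uᴴ) ^ 2 - (U - Uᴴ) ^ 2 = (4 : ℂ) • 1 := by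
    simp only [sq, add_mul, mul_add, sub_mul, mul_sub, h1, h2]
    rw [show (4 : ℂ) = 1 + 1 + 1 + 1 by norm_num, add_smul, add_smul, add_smul, one_smul]
    abel
  rw [h4, smul_smul]
  norm_num

theorem norm_commutator_conjTranspose_le (hU : U ∈ Matrix.unitaryGroup ι ℂ) (B : Matrix ι ι ℂ) :
    ‖Uᴴ * B - B * Uᴴ‖ ≤ ‖U * B - B * U‖ := by
  have h1 : U * Uᴴ = 1 := Matrix.mem_unitaryGroup_iff.1 hU
  have h2 : Uᴴ * U = 1 := Matrix.mem_unitaryGroup_iff'.1 hU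
  have h3 : Uᴴ * B - B * Uᴴ = -(Uᴴ * (U * B - B * U) * Uᴴ) := by
    rw [mul_sub, sub_mul, ← mul_assoc, h2, one_mul, mul_assoc, mul_assoc, h1, mul_one, neg_sub]
  have hn : ‖Uᴴ‖ ≤ 1 := l2_opNorm_le_one_of_isometry (by rw [conjTranspose_conjTranspose, h1])
  rw [h3, norm_neg]
  simpa using l2_opNorm_mul_le_of_le (l2_opNorm_mul_le_of_le hn le_rfl) hn

theorem norm_smul_add_conjTranspose_le (hU : U ∈ Matrix.unitaryGroup ι ℂ) {a s : ℂ}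
    (ha : ‖a‖ = 1 / 2) (hs : ‖s‖ = 1) : ‖a • (U + s • Uᴴ)‖ ≤ 1 := by
  have h1 := l2_opNorm_le_one_of_mem_unitaryGroup hU
  have h2 : ‖Uᴴ‖ ≤ 1 := l2_opNorm_le_one_of_mem_unitaryGroup (Unitary.star_mem hU)
  have h3 := norm_add_le U (s • Uᴴ)
  rw [norm_smul, hs, one_mul] at h3
  rw [norm_smul, ha]
  linarith

theorem norm_commutator_smul_add_conjTranspose_le (hU : U ∈ Matrix.unitaryGroup ι ℂ)
    {a s : ℂ} (ha : ‖a‖ = 1 / 2) (hs : ‖s‖ = 1) (B : Matrix ι ι ℂ) :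
    ‖a • (U + s • Uᴴ) * B - B * (a • (U + s • Uᴴ))‖ ≤ ‖U * B - B * U‖ := by
  have h1 : a • (U + s • Uᴴ) * B - B * (a • (U + s • Uᴴ)) =
      a • ((U * B - B * U) + s • (Uᴴ * B - B * Uᴴ)) := by
    simp only [smul_add, add_mul, mul_add, smul_sub, Matrix.smul_mul, Matrix.mul_smul]
    abel
  have h3 := norm_add_le (U * B - B * U) (s • (Uᴴ * B - B * Uᴴ))
  rw [norm_smul, hs, one_mul] at h3
  rw [h1, norm_smul, ha]
  linarith [norm_commutator_conjTranspose_le hU B]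

theorem rePart_eq_smul (U : Matrix ι ι ℂ) : rePart U = (2 : ℂ)⁻¹ • (U + (1 : ℂ) • Uᴴ) := by
  rw [one_smul, rePart]

theorem imPart_eq_smul (U : Matrix ι ι ℂ) :
    imPart U = (2 * Complex.I)⁻¹ • (U + (-1 : ℂ) • Uᴴ) := by
  rw [neg_one_smul, ← sub_eq_add_neg, imPart]

theorem norm_rePart_le (hU : U ∈ Matrix.unitaryGroup ι ℂ) : ‖rePart U‖ ≤ 1 := by
  rw [rePart_eq_smul]
  exact norm_smul_add_conjTranspose_le hU (by norm_num) (by simp)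

theorem norm_imPart_le (hU : U ∈ Matrix.unitaryGroup ι ℂ) : ‖imPart U‖ ≤ 1 := by
  rw [imPart_eq_smul]
  exact norm_smul_add_conjTranspose_le hU (by norm_num) (by simp)

theorem norm_commutator_rePart_le (hU : U ∈ Matrix.unitaryGroup ι ℂ) (B : Matrix ι ι ℂ) :
    ‖rePart U * B - B * rePart U‖ ≤ ‖U * B - B * U‖ := by
  rw [rePart_eq_smul]
  exact norm_commutator_smul_add_conjTranspose_le hU (by norm_num) (by simp) B

theorem norm_commutator_imPart_le (hU : U ∈ Matrix.unitaryGroup ι ℂ) (B : Matrix ι ι ℂ) :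
    ‖imPart U * B - B * imPart U‖ ≤ ‖U * B - B * U‖ := by
  rw [imPart_eq_smul]
  exact norm_commutator_smul_add_conjTranspose_le hU (by norm_num) (by simp) B

theorem norm_commutator_right_rePart_le (hV : V ∈ Matrix.unitaryGroup ι ℂ) (B : Matrix ι ι ℂ) :
    ‖B * rePart V - rePart V * B‖ ≤ ‖B * V - V * B‖ := by
  rw [norm_sub_rev, norm_sub_rev (B * V)]
  exact norm_commutator_rePart_le hV B

theorem norm_commutator_right_imPart_le (hV : V ∈ Matrix.unitaryGroup ι ℂ) (B : Matrix ι ι ℂ) :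
    ‖B * imPart V - imPart V * B‖ ≤ ‖B * V - V * B‖ := by
  rw [norm_sub_rev, norm_sub_rev (B * V)]
  exact norm_commutator_imPart_le hV B

theorem norm_commutator_sq_le {A G : Matrix ι ι ℂ} (hG : ‖G‖ ≤ 1) {γ : ℝ}
    (h : ‖A * G - G * A‖ ≤ γ) : ‖A * G ^ 2 - G ^ 2 * A‖ ≤ 2 * γ := by
  have h1 : A * G ^ 2 - G ^ 2 * A = (A * G - G * A) * G + G * (A * G - G * A) := by
    noncomm_ring
  rw [h1]
  refine (norm_add_le _ _).trans ?_
  linarith [l2_opNorm_mul_le_of_le h hG, l2_opNorm_mul_le_of_le hG h]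

end CartesianParts

/-! ### First and second moments of the POVM -/

section Moments

variable {ι : Type} [Fintype ι] [DecidableEq ι] {F : ℝ → ℝ} {Δ K : ℝ} {d : ℕ}
  {T : Fin d → Matrix ι ι ℂ}

theorem povmE_eq_orderedProd (F : ℝ → ℝ) (Δ : ℝ) (T : Fin d → Matrix ι ι ℂ)
    (k : PovmIndex d Δ) :
    povmE F Δ T k =
      (orderedProd (fun i (m : Finset.Icc (-⌈1 / Δ⌉) ⌈1 / Δ⌉) => windowOp F Δ (rePart (T i)) m) k.1 *
        orderedProd (fun i (m : Finset.Icc (-⌈1 / Δ⌉) ⌈1 / Δ⌉) => windowOp F Δ (imPart (T i)) m) k.2) *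
      (orderedProd (fun i (m : Finset.Icc (-⌈1 / Δ⌉) ⌈1 / Δ⌉) => windowOp F Δ (rePart (T i)) m) k.1 *
        orderedProd (fun i (m : Finset.Icc (-⌈1 / Δ⌉) ⌈1 / Δ⌉) => windowOp F Δ (imPart (T i)) m) k.2)ᴴ :=
  rfl

theorem sum_windowOp_mul_conjTranspose (hF : IsWindow F) (hΔ : 0 < Δ) {X : Matrix ι ι ℂ}
    (hX : X.IsHermitian) (hX1 : ‖X‖ ≤ 1) :
    ∑ m : Finset.Icc (-⌈1 / Δ⌉) ⌈1 / Δ⌉, windowOp F Δ X m * (windowOp F Δ X m)ᴴ = 1 := by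
  simp_rw [windowOp_conjTranspose]
  exact sum_windowOp_mul_self hF hΔ hX hX1

theorem sum_povmE (hF : IsWindow F) (hΔ : 0 < Δ)
    (hT : ∀ i, T i ∈ Matrix.unitaryGroup ι ℂ) : ∑ k, povmE F Δ T k = 1 := by
  simp_rw [povmE_eq_orderedProd]
  exact sum_pair_orderedProd_mul_conjTranspose
    (fun i => sum_windowOp_mul_conjTranspose hF hΔ (rePart_isHermitian _) (norm_rePart_le (hT i)))
    (fun i => sum_windowOp_mul_conjTranspose hF hΔ (imPart_isHermitian _) (norm_imPart_le (hT i)))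

/-- The bound on averages over windows provided by `IsWindow.exists_norm_average_sub_le`. -/
def IsAverageBound (F : ℝ → ℝ) (K : ℝ) : Prop :=
  ∀ (ι : Type) [Fintype ι] [DecidableEq ι] (Δ : ℝ) (X Z : Matrix ι ι ℂ),
    0 < Δ → X.IsHermitian → ‖X‖ ≤ 1 →
    ‖∑ m : Finset.Icc (-⌈1 / Δ⌉) ⌈1 / Δ⌉, windowOp F Δ X m * Z * windowOp F Δ X m - Z‖ ≤
      K / Δ * ‖X * Z - Z * X‖

theorem IsAverageBound.norm_sum_conj_sub_le (hK : IsAverageBound F K) (hK0 : 0 ≤ K) (hΔ : 0 < Δ)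
    {X Z : Matrix ι ι ℂ} (hX : X.IsHermitian) (hX1 : ‖X‖ ≤ 1) {γ : ℝ}
    (h : ‖X * Z - Z * X‖ ≤ γ) :
    ‖∑ m : Finset.Icc (-⌈1 / Δ⌉) ⌈1 / Δ⌉, windowOp F Δ X m * Z * (windowOp F Δ X m)ᴴ - Z‖ ≤
      K / Δ * γ := by
  simp_rw [windowOp_conjTranspose]
  refine (hK ι Δ X Z hΔ hX hX1).trans ?_
  gcongr

theorem norm_sum_smul_povmE_sub_rePart_le (hF : IsWindow F) (hK : IsAverageBound F K)
    (hK0 : 0 ≤ K) (hΔ : 0 < Δ) (hT : ∀ i, T i ∈ Matrix.unitaryGroup ι ℂ) (i : Fin d)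
    {γ b : ℝ} (p : ℕ) (a : ℤ → ℝ) (hb : 0 ≤ b)
    (hγ : ∀ j, ‖rePart (T j) * rePart (T i) ^ p - rePart (T i) ^ p * rePart (T j)‖ ≤ γ)
    (ha : ∀ (m : ℤ) (x : ℝ), |x| ≤ 1 → |x / Δ - m| < 1 → |a m - x ^ p| ≤ b) :
    ‖∑ k : PovmIndex d Δ, (a (k.1 i) : ℂ) • povmE F Δ T k - rePart (T i) ^ p‖ ≤
      b + 2 * (d * (K / Δ * γ)) := by
  simp_rw [povmE_eq_orderedProd]
  refine norm_sum_smul_fst_orderedProd_sub_le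
    (fun i => sum_windowOp_mul_conjTranspose hF hΔ (rePart_isHermitian _) (norm_rePart_le (hT i)))
    (fun i => sum_windowOp_mul_conjTranspose hF hΔ (imPart_isHermitian _) (norm_imPart_le (hT i)))
    (fun m : Finset.Icc (-⌈1 / Δ⌉) ⌈1 / Δ⌉ => (a m : ℂ)) i (fun j => ?_) ?_
  · exact hK.norm_sum_conj_sub_le hK0 hΔ (rePart_isHermitian _) (norm_rePart_le (hT j)) (hγ j)
  · simp_rw [windowOp_conjTranspose]
    exact sum_smul_windowOp_mul_self_sub_le hF hΔ (rePart_isHermitian _) (norm_rePart_le (hT i))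
      a p hb ha

theorem norm_sum_smul_povmE_sub_imPart_le (hF : IsWindow F) (hK : IsAverageBound F K)
    (hK0 : 0 ≤ K) (hΔ : 0 < Δ) (hT : ∀ i, T i ∈ Matrix.unitaryGroup ι ℂ) (i : Fin d)
    {γ b : ℝ} (p : ℕ) (a : ℤ → ℝ) (hb : 0 ≤ b)
    (hγ : ∀ j, ‖rePart (T j) * imPart (T i) ^ p - imPart (T i) ^ p * rePart (T j)‖ ≤ γ)
    (hγ' : ∀ j, ‖imPart (T j) * imPart (T i) ^ p - imPart (T i) ^ p * imPart (T j)‖ ≤ γ)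
    (ha : ∀ (m : ℤ) (x : ℝ), |x| ≤ 1 → |x / Δ - m| < 1 → |a m - x ^ p| ≤ b) :
    ‖∑ k : PovmIndex d Δ, (a (k.2 i) : ℂ) • povmE F Δ T k - imPart (T i) ^ p‖ ≤
      b + 2 * (d * (K / Δ * γ)) := by
  simp_rw [povmE_eq_orderedProd]
  refine norm_sum_smul_snd_orderedProd_sub_le
    (fun i => sum_windowOp_mul_conjTranspose hF hΔ (rePart_isHermitian _) (norm_rePart_le (hT i)))
    (fun i => sum_windowOp_mul_conjTranspose hF hΔ (imPart_isHermitian _) (norm_imPart_le (hT i)))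
    (fun m : Finset.Icc (-⌈1 / Δ⌉) ⌈1 / Δ⌉ => (a m : ℂ)) i (fun j => ?_) (fun j => ?_) ?_
  · exact hK.norm_sum_conj_sub_le hK0 hΔ (rePart_isHermitian _) (norm_rePart_le (hT j)) (hγ j)
  · exact hK.norm_sum_conj_sub_le hK0 hΔ (imPart_isHermitian _) (norm_imPart_le (hT j)) (hγ' j)
  · simp_rw [windowOp_conjTranspose]
    exact sum_smul_windowOp_mul_self_sub_le hF hΔ (imPart_isHermitian _) (norm_imPart_le (hT i))
      a p hb ha

theorem abs_mul_sub_le_of_abs_div_sub_lt (hΔ : 0 < Δ) {m : ℤ} {x : ℝ} (h : |x / Δ - m| < 1) :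
    |m * Δ - x| ≤ Δ := by
  have h1 : m * Δ - x = -(x / Δ - m) * Δ := by field_simp; ring
  rw [h1, abs_mul, abs_neg, abs_of_pos hΔ]
  nlinarith

theorem abs_sq_sub_sq_le_of_abs_div_sub_lt (hΔ : 0 < Δ) (hΔ1 : Δ ≤ 1) {m : ℤ} {x : ℝ}
    (hx : |x| ≤ 1) (h : |x / Δ - m| < 1) : |(m * Δ) ^ 2 - x ^ 2| ≤ 3 * Δ := by
  have h1 := abs_mul_sub_le_of_abs_div_sub_lt hΔ h
  have h2 : |m * Δ + x| ≤ 3 := by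
    have h3 : (m * Δ + x : ℝ) = (m * Δ - x) + 2 * x := by ring
    rw [h3]
    refine (abs_add_le _ _).trans ?_
    rw [abs_mul, abs_two]
    linarith
  rw [sq_sub_sq, abs_mul]
  exact mul_le_mul h2 h1 (abs_nonneg _) (by norm_num)

/-- The eigenvalue `(m i + √-1 n i) Δ` of `dilatedV Q i` on the range of `Q (m, n)`. -/
def gridPoint {d : ℕ} {Δ : ℝ} (i : Fin d) (k : PovmIndex d Δ) : ℂ :=
  ((k.1 i : ℤ) : ℂ) * (Δ : ℂ) + Complex.I * (((k.2 i : ℤ) : ℂ) * (Δ : ℂ))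

theorem abs_grid_le (hΔ : 0 < Δ) (hΔ1 : Δ ≤ 1) (m : Finset.Icc (-⌈1 / Δ⌉) ⌈1 / Δ⌉) :
    ‖((m : ℤ) : ℂ) * (Δ : ℂ)‖ ≤ 2 := by
  have h1 : |(m : ℤ)| ≤ ⌈1 / Δ⌉ := abs_le.2 (Finset.mem_Icc.1 m.2)
  have h2 : |((m : ℤ) : ℝ)| ≤ (⌈1 / Δ⌉ : ℤ) := by exact_mod_cast h1
  have h3 := (Int.ceil_lt_add_one (1 / Δ)).le
  rw [norm_mul, Complex.norm_real, Complex.norm_intCast, Real.norm_eq_abs, abs_of_pos hΔ]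
  have h4 : 1 / Δ * Δ = 1 := by field_simp
  nlinarith

theorem norm_gridPoint_le (hΔ : 0 < Δ) (hΔ1 : Δ ≤ 1) (i : Fin d) (k : PovmIndex d Δ) :
    ‖gridPoint i k‖ ≤ 4 := by
  refine (norm_add_le _ _).trans ?_
  rw [norm_mul Complex.I, Complex.norm_I, one_mul]
  linarith [abs_grid_le hΔ hΔ1 (k.1 i), abs_grid_le hΔ hΔ1 (k.2 i)]

theorem star_gridPoint_mul (i : Fin d) (k : PovmIndex d Δ) :
    star (gridPoint i k) * gridPoint i k =
      ((((k.1 i : ℤ) * Δ) ^ 2 : ℝ) : ℂ) + ((((k.2 i : ℤ) * Δ) ^ 2 : ℝ) : ℂ) := by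
  have hI := Complex.I_mul_I
  simp only [gridPoint, Complex.star_def, map_add, map_mul, Complex.conj_I, Complex.conj_ofReal,
    map_intCast]
  push_cast
  linear_combination (-(((k.2 i : ℤ) : ℂ) * Δ) ^ 2) * hI

end Moments

/-! ### The dilated phases on the original space -/

section Dilated

variable {ι κ : Type} [Fintype ι] [DecidableEq ι] [Fintype κ] [DecidableEq κ] {F : ℝ → ℝ}
  {Δ ε K : ℝ} {d : ℕ} {T : Fin d → Matrix ι ι ℂ} {W : Matrix κ ι ℂ}
  {Q : PovmIndex d Δ → Matrix κ κ ℂ}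

/-- The functional calculus of the resolution of the identity of a Naimark dilation. -/
def IsNaimark.starAlgHom {α : Type*} [Fintype α] {E : α → Matrix ι ι ℂ} {Q : α → Matrix κ κ ℂ}
    (h : IsNaimark E W Q) : (α → ℂ) →⋆ₐ[ℂ] Matrix κ κ ℂ :=
  resolutionStarAlgHom Q h.projector h.orthogonal h.complete

theorem IsNaimark.compress_starAlgHom {α : Type*} [Fintype α] {E : α → Matrix ι ι ℂ}
    {Q : α → Matrix κ κ ℂ} (h : IsNaimark E W Q) (c : α → ℂ) :
    Wᴴ * h.starAlgHom c * W = ∑ k, c k • E k := by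
  change Wᴴ * (∑ k, c k • Q k) * W = _
  simp_rw [Matrix.mul_sum, Matrix.sum_mul, Matrix.mul_smul, Matrix.smul_mul, h.compress]

theorem IsNaimark.dilatedV_eq {E : PovmIndex d Δ → Matrix ι ι ℂ} (h : IsNaimark E W Q)
    (i : Fin d) : dilatedV Q i = h.starAlgHom (gridPoint i) := by
  change _ = ∑ k, gridPoint i k • Q k
  simp_rw [dilatedV, gridPoint, add_smul, Finset.sum_add_distrib, Finset.smul_sum, smul_smul]

theorem IsNaimark.eq_of_tendsto_polar {E : PovmIndex d Δ → Matrix ι ι ℂ} (h : IsNaimark E W Q)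
    {z : ℂ} (hz : ‖z‖ = 1) {i : Fin d} {U : Matrix κ κ ℂ}
    (hU : Tendsto (fun x : ℝ => polar (dilatedV Q i + ((x : ℂ) * z) • 1)) (𝓝[>] 0) (𝓝 U)) :
    U = h.starAlgHom fun k => phaseOr z (gridPoint i k) := by
  rw [h.dilatedV_eq] at hU
  exact tendsto_nhds_unique hU (tendsto_polar_starAlgHom _ _ hz)

theorem starAlgHom_mem_unitaryGroup {α : Type*} (φ : (α → ℂ) →⋆ₐ[ℂ] Matrix κ κ ℂ) {u : α → ℂ}
    (hu : ∀ k, ‖u k‖ = 1) : φ u ∈ Matrix.unitaryGroup κ ℂ := by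
  rw [Matrix.mem_unitaryGroup_iff, ← map_star, ← map_mul, ← map_one φ]
  congr 1
  ext k
  simp [Complex.mul_conj', hu k]

theorem norm_phase_dilation_le_of_le_one (hF : IsWindow F) (hK : IsAverageBound F K)
    (hK0 : 0 ≤ K) (hΔ : 0 < Δ) (hΔ1 : Δ ≤ 1) (hΔε : Δ ^ 2 = d * ε) (hT : IsSoftTorus ε T)
    (h : IsNaimark (povmE F Δ T) W Q) {z : ℂ} (hz : ‖z‖ = 1) (i : Fin d) :
    ‖h.starAlgHom (fun k => phaseOr z (gridPoint i k)) * W - W * T i‖ ≤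
      6 * √((10 + 16 * K) * Δ) ∧
    ‖(h.starAlgHom (fun k => phaseOr z (gridPoint i k)))ᴴ * W - W * (T i)ᴴ‖ ≤
      6 * √((10 + 16 * K) * Δ) := by
  have hTu := hT.1
  -- The choice `Δ ^ 2 = d * ε` makes the cost of `d` averagings comparable to the grid spacing.
  have hd : d * (K / Δ * ε) = K * Δ := by
    field_simp
    linear_combination (-K) * hΔε
  have hd2 : d * (K / Δ * (2 * ε)) = 2 * (K * Δ) := by
    linear_combination 2 * hd
  have hrr : ∀ j, ‖rePart (T j) * rePart (T i) - rePart (T i) * rePart (T j)‖ ≤ ε := fun j =>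
    (norm_commutator_rePart_le (hTu j) _).trans
      ((norm_commutator_right_rePart_le (hTu i) _).trans (hT.2 j i))
  have hri : ∀ j, ‖rePart (T j) * imPart (T i) - imPart (T i) * rePart (T j)‖ ≤ ε := fun j =>
    (norm_commutator_rePart_le (hTu j) _).trans
      ((norm_commutator_right_imPart_le (hTu i) _).trans (hT.2 j i))
  have hii : ∀ j, ‖imPart (T j) * imPart (T i) - imPart (T i) * imPart (T j)‖ ≤ ε := fun j =>
    (norm_commutator_imPart_le (hTu j) _).trans
      ((norm_commutator_right_imPart_le (hTu i) _).trans (hT.2 j i))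
  have hX1 := norm_sum_smul_povmE_sub_rePart_le hF hK hK0 hΔ hTu i 1 (fun m => m * Δ) hΔ.le
    (by simpa using hrr) (fun m x _ hmx => by
      simpa using abs_mul_sub_le_of_abs_div_sub_lt hΔ hmx)
  have hY1 := norm_sum_smul_povmE_sub_imPart_le hF hK hK0 hΔ hTu i 1 (fun m => m * Δ) hΔ.le
    (by simpa using hri) (by simpa using hii) (fun m x _ hmx => by
      simpa using abs_mul_sub_le_of_abs_div_sub_lt hΔ hmx)
  have hX2 := norm_sum_smul_povmE_sub_rePart_le hF hK hK0 hΔ hTu i 2 (fun m => (m * Δ) ^ 2)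
    (b := 3 * Δ) (by positivity) (fun j => norm_commutator_sq_le (norm_rePart_le (hTu i)) (hrr j))
    (fun m x hx hmx => abs_sq_sub_sq_le_of_abs_div_sub_lt hΔ hΔ1 hx hmx)
  have hY2 := norm_sum_smul_povmE_sub_imPart_le hF hK hK0 hΔ hTu i 2 (fun m => (m * Δ) ^ 2)
    (b := 3 * Δ) (by positivity) (fun j => norm_commutator_sq_le (norm_imPart_le (hTu i)) (hri j))
    (fun j => norm_commutator_sq_le (norm_imPart_le (hTu i)) (hii j))
    (fun m x hx hmx => abs_sq_sub_sq_le_of_abs_div_sub_lt hΔ hΔ1 hx hmx)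
  rw [pow_one, hd] at hX1 hY1
  rw [hd2] at hX2 hY2
  have h1 : ‖Wᴴ * h.starAlgHom (gridPoint i) * W - T i‖ ≤ 2 * (Δ + 2 * (K * Δ)) := by
    have : Wᴴ * h.starAlgHom (gridPoint i) * W - T i =
        (∑ k : PovmIndex d Δ, (((k.1 i : ℤ) * Δ : ℝ) : ℂ) • povmE F Δ T k - rePart (T i)) +
        Complex.I • (∑ k : PovmIndex d Δ, (((k.2 i : ℤ) * Δ : ℝ) : ℂ) • povmE F Δ T k -
          imPart (T i)) := by
      rw [h.compress_starAlgHom]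
      conv_lhs => rw [← rePart_add_imPart (T i)]
      simp_rw [gridPoint, add_smul, Finset.sum_add_distrib, smul_sub, Finset.smul_sum, smul_smul]
      push_cast
      abel
    rw [this]
    refine (norm_add_le _ _).trans ?_
    rw [norm_smul, Complex.norm_I, one_mul]
    linarith
  have h2 : ‖Wᴴ * h.starAlgHom (star (gridPoint i) * gridPoint i) * W - 1‖ ≤
      2 * (3 * Δ + 2 * (2 * (K * Δ))) := by
    have : Wᴴ * h.starAlgHom (star (gridPoint i) * gridPoint i) * W - 1 =
        (∑ k : PovmIndex d Δ, ((((k.1 i : ℤ) * Δ) ^ 2 : ℝ) : ℂ) • povmE F Δ T k -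
          rePart (T i) ^ 2) +
        (∑ k : PovmIndex d Δ, ((((k.2 i : ℤ) * Δ) ^ 2 : ℝ) : ℂ) • povmE F Δ T k -
          imPart (T i) ^ 2) := by
      rw [h.compress_starAlgHom, ← rePart_sq_add_imPart_sq (hTu i)]
      simp_rw [Pi.mul_apply, Pi.star_apply, star_gridPoint_mul, add_smul, Finset.sum_add_distrib]
      abel
    rw [this]
    refine (norm_add_le _ _).trans ?_
    linarith
  -- This is `(R + 2) * √(b + 2 * a)` with `R = 4` from `norm_gridPoint_le` and `a`, `b` the moment
  -- errors in `h1`, `h2`.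
  have h3 : (4 + 2) * √(2 * (3 * Δ + 2 * (2 * (K * Δ))) + 2 * (2 * (Δ + 2 * (K * Δ)))) =
      6 * √((10 + 16 * K) * Δ) := by
    rw [show 2 * (3 * Δ + 2 * (2 * (K * Δ))) + 2 * (2 * (Δ + 2 * (K * Δ))) =
      (10 + 16 * K) * Δ by ring]
    norm_num
  rw [← h3]
  exact ⟨norm_phase_mul_isometry_sub_le hz h.isometry (hTu i) (norm_gridPoint_le hΔ hΔ1 i)
    (by norm_num) h1 h2, norm_conjTranspose_phase_mul_isometry_sub_le hz h.isometry (hTu i)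
    (norm_gridPoint_le hΔ hΔ1 i) (by norm_num) h1 h2⟩

theorem norm_phase_dilation_le (hF : IsWindow F) (hK : IsAverageBound F K)
    (hK0 : 0 ≤ K) (hΔ : 0 < Δ) (hΔε : Δ ^ 2 = d * ε) (hT : IsSoftTorus ε T)
    (h : IsNaimark (povmE F Δ T) W Q) {z : ℂ} (hz : ‖z‖ = 1) (i : Fin d) :
    ‖h.starAlgHom (fun k => phaseOr z (gridPoint i k)) * W - W * T i‖ ≤
      6 * √(10 + 16 * K) * √Δ ∧
    ‖(h.starAlgHom (fun k => phaseOr z (gridPoint i k)))ᴴ * W - W * (T i)ᴴ‖ ≤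
      6 * √(10 + 16 * K) * √Δ := by
  rcases le_total Δ 1 with h1 | h1
  · rw [mul_assoc, ← Real.sqrt_mul (by positivity)]
    exact norm_phase_dilation_le_of_le_one hF hK hK0 hΔ h1 hΔε hT h hz i
  -- For a coarse grid the claimed bound exceeds `2`, the trivial bound for a difference of
  -- contractions.
  · have h2 : 1 ≤ √(10 + 16 * K) := Real.one_le_sqrt.2 (by linarith)
    have h3 : 1 ≤ √Δ := Real.one_le_sqrt.2 h1
    have hWn := l2_opNorm_le_one_of_isometry h.isometry
    have hU := l2_opNorm_le_one_of_mem_unitaryGroup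
      (starAlgHom_mem_unitaryGroup h.starAlgHom fun k => norm_phaseOr hz (gridPoint i k))
    have hU' := (Matrix.l2_opNorm_conjTranspose _).trans_le hU
    have hTn := l2_opNorm_le_one_of_mem_unitaryGroup (hT.1 i)
    have hTn' := (Matrix.l2_opNorm_conjTranspose _).trans_le hTn
    have h6 : (2 : ℝ) ≤ 6 * √(10 + 16 * K) * √Δ := by nlinarith
    constructor
    · refine (norm_sub_le _ _).trans ?_
      linarith [l2_opNorm_mul_le_of_le hU hWn, l2_opNorm_mul_le_of_le hWn hTn]
    · refine (norm_sub_le _ _).trans ?_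
      linarith [l2_opNorm_mul_le_of_le hU' hWn, l2_opNorm_mul_le_of_le hWn hTn']

end Dilated

/-! ### Values of `ℱ` and their existence -/

section MapF

variable {ι κ : Type} [Fintype ι] [DecidableEq ι] [Fintype κ] [DecidableEq κ] {F : ℝ → ℝ}
  {ε K : ℝ} {d : ℕ} {T : Fin d → Matrix ι ι ℂ}

theorem IsMapF.exists_isometry_close (hF : IsWindow F) (hK : IsAverageBound F K) (hK0 : 0 ≤ K)
    (hd : 0 < d) (hε : 0 < ε) (hT : IsSoftTorus ε T) {M : ProjTuple d κ} (hM : IsMapF F ε T M) :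
    M.IsExact ∧ ∃ W : Matrix κ ι ℂ, Wᴴ * W = 1 ∧ M.P = W * Wᴴ ∧
      ∀ i, ‖M.U i * W - W * T i‖ ≤ 6 * √(10 + 16 * K) * √√(d * ε) ∧
        ‖(M.U i)ᴴ * W - W * (T i)ᴴ‖ ≤ 6 * √(10 + 16 * K) * √√(d * ε) := by
  obtain ⟨W, Q, z, h, hz, -, hP, hU⟩ := hM
  have hd' : (0 : ℝ) < d := by exact_mod_cast hd
  have hΔ : 0 < √(d * ε) := Real.sqrt_pos.2 (by positivity)
  have hΔε : √(d * ε) ^ 2 = d * ε := Real.sq_sqrt (by positivity)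
  have hUi := fun i => h.eq_of_tendsto_polar hz (hU i)
  refine ⟨⟨fun i => ?_, fun i j => ?_, ?_⟩, W, h.isometry, hP, fun i => ?_⟩
  · rw [hUi]
    exact starAlgHom_mem_unitaryGroup _ fun k => norm_phaseOr hz _
  · rw [hUi, hUi, ← map_mul, ← map_mul]
    exact congrArg _ (mul_comm _ _)
  · rw [hP]
    constructor
    · rw [IsIdempotentElem, Matrix.mul_assoc, ← Matrix.mul_assoc Wᴴ, h.isometry, Matrix.one_mul]
    · simp [IsSelfAdjoint, Matrix.star_eq_conjTranspose]
  · rw [hUi]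
    exact norm_phase_dilation_le hF hK hK0 hΔ hΔε hT h hz i

theorem exists_unit_complex_notMem (s : Finset ℂ) : ∃ z : ℂ, ‖z‖ = 1 ∧ z ∉ s := by
  have hinj : Function.Injective fun n : ℕ => Complex.exp ((1 / (n + 1 : ℝ) : ℝ) * Complex.I) := by
    intro m n h
    have hpos : ∀ n : ℕ, 0 < 1 / (n + 1 : ℝ) := fun n => by positivity
    have hle : ∀ n : ℕ, 1 / (n + 1 : ℝ) ≤ 1 := fun n => by
      rw [div_le_one (by positivity)]
      linarith [Nat.cast_nonneg (α := ℝ) n]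
    have harg : ∀ n : ℕ, Complex.arg (Complex.exp ((1 / (n + 1 : ℝ) : ℝ) * Complex.I)) =
        1 / (n + 1 : ℝ) := fun n => by
      rw [Complex.arg_exp_mul_I, toIocMod_eq_self]
      constructor
      · linarith [hpos n, Real.pi_pos]
      · linarith [hle n, Real.pi_gt_three]
    have h1 := congrArg Complex.arg h
    simp only [harg] at h1
    have h2 : (m + 1 : ℝ) = n + 1 := by
      rw [div_eq_div_iff (by positivity) (by positivity)] at h1
      linarith
    exact_mod_cast add_right_cancel h2
  obtain ⟨z, hz, hzs⟩ := (Set.infinite_range_of_injective hinj).exists_notMem_finset s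
  obtain ⟨n, rfl⟩ := hz
  exact ⟨_, Complex.norm_exp_ofReal_mul_I _, hzs⟩

theorem exists_isMapF (hF : IsWindow F) (hd : 0 < d) (hε : 0 < ε) (hT : IsSoftTorus ε T) :
    ∃ (N : ℕ) (M : ProjTuple d (Fin N)), IsMapF F ε T M := by
  have hd' : (0 : ℝ) < d := by exact_mod_cast hd
  have hΔ : 0 < √(d * ε) := Real.sqrt_pos.2 (by positivity)
  have hN := isNaimark_blockColumn (A := povmA F √(d * ε) T) (sum_povmE hF hΔ hT.1)
  let e := (Fintype.equivFin (ι × PovmIndex d √(d * ε))).symm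
  have h := hN.submatrix e
  set W := (blockColumn (povmA F √(d * ε) T)).submatrix e id
  set Q := fun k => (Matrix.blockDiagonal (Pi.single k (1 : Matrix ι ι ℂ))).submatrix e e
  -- Singularity of `V i + x z` would make some grid value equal to `-x z`, so `z` only has to avoid
  -- the negatives of finitely many phases. The grid value `0` contributes `0`, which excludes no
  -- unit `z`.
  obtain ⟨z, hz, hzs⟩ := exists_unit_complex_notMem
    (Finset.univ.image fun p : Fin d × PovmIndex d √(d * ε) =>
      -(gridPoint p.1 p.2 / ‖gridPoint p.1 p.2‖))
  refine ⟨_, ⟨fun i => h.starAlgHom fun k => phaseOr z (gridPoint i k), W * Wᴴ⟩, W, Q, z, h, hz,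
    fun i x hx _ => ?_, rfl, fun i => ?_⟩
  · rw [h.dilatedV_eq, starAlgHom_add_smul_one]
    refine IsUnit.map h.starAlgHom (Pi.isUnit_iff.2 fun k => IsUnit.mk0 _ fun h0 => hzs ?_)
    refine Finset.mem_image.2 ⟨(i, k), Finset.mem_univ _, ?_⟩
    have h1 : gridPoint i k = -(x * z) := eq_neg_of_add_eq_zero_left h0
    have hxc : (x : ℂ) ≠ 0 := by exact_mod_cast hx.ne'
    dsimp only
    rw [h1, norm_neg, norm_mul, hz, Complex.norm_real, Real.norm_eq_abs, abs_of_pos hx]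
    field_simp
  · rw [h.dilatedV_eq]
    exact tendsto_polar_starAlgHom _ _ hz

end MapF

/-! ### Comparing local projectors through their corners -/

section Distance

variable {ι κ ρ ρ' : Type*} [Fintype ι] [DecidableEq ι] [Fintype κ] [DecidableEq κ]
  [Fintype ρ] [DecidableEq ρ] [Fintype ρ'] [DecidableEq ρ']

/-- The unitary that exchanges the ranges of `W` and `W'` along `Y` and fixes their complements. -/
def exchangeUnitary (W : Matrix ι ρ ℂ) (W' : Matrix κ ρ' ℂ) (Y : Matrix ρ ρ' ℂ) :
    Matrix (ι ⊕ κ) (κ ⊕ ι) ℂ :=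
  Matrix.fromBlocks (W * Y * W'ᴴ) (1 - W * Wᴴ) (1 - W' * W'ᴴ) (W' * Yᴴ * Wᴴ)

variable {W : Matrix ι ρ ℂ} {W' : Matrix κ ρ' ℂ} {Y : Matrix ρ ρ' ℂ}

theorem exchangeUnitary_conjTranspose (W : Matrix ι ρ ℂ) (W' : Matrix κ ρ' ℂ)
    (Y : Matrix ρ ρ' ℂ) :
    (exchangeUnitary W W' Y)ᴴ = exchangeUnitary W' W Yᴴ := by
  simp [exchangeUnitary, Matrix.fromBlocks_conjTranspose, Matrix.conjTranspose_mul,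
    Matrix.mul_assoc]

theorem mul_isometry_cancel {μ : Type*} [Fintype μ] (hW : Wᴴ * W = 1) (B : Matrix ρ μ ℂ) :
    Wᴴ * (W * B) = B := by
  rw [← Matrix.mul_assoc, hW, Matrix.one_mul]

theorem exchangeUnitary_mul (hW : Wᴴ * W = 1) (hW' : W'ᴴ * W' = 1) (hY : Y * Yᴴ = 1)
    (hY' : Yᴴ * Y = 1) :
    exchangeUnitary W W' Y * exchangeUnitary W' W Yᴴ = 1 := by
  have hYc : ∀ B : Matrix ρ ι ℂ, Y * (Yᴴ * B) = B := fun B => by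
    rw [← Matrix.mul_assoc, hY, Matrix.one_mul]
  have hYc' : ∀ B : Matrix ρ' κ ℂ, Yᴴ * (Y * B) = B := fun B => by
    rw [← Matrix.mul_assoc, hY', Matrix.one_mul]
  rw [exchangeUnitary, exchangeUnitary, Matrix.fromBlocks_multiply, ← Matrix.fromBlocks_one]
  simp only [Matrix.conjTranspose_conjTranspose, Matrix.mul_sub, Matrix.sub_mul, Matrix.mul_one,
    Matrix.one_mul, Matrix.mul_assoc, mul_isometry_cancel hW, mul_isometry_cancel hW', hYc, hYc',
    sub_self, sub_zero, add_sub_cancel, sub_add_cancel, add_zero]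

theorem exchangeUnitary_isUnitaryMap (hW : Wᴴ * W = 1) (hW' : W'ᴴ * W' = 1)
    (hY : IsUnitaryMap Y) : IsUnitaryMap (exchangeUnitary W W' Y) := by
  rw [IsUnitaryMap, exchangeUnitary_conjTranspose]
  refine ⟨?_, exchangeUnitary_mul hW hW' hY.2 hY.1⟩
  have := exchangeUnitary_mul hW' hW (Y := Yᴴ) (by simpa using hY.1) (by simpa using hY.2)
  rwa [Matrix.conjTranspose_conjTranspose] at this

theorem exchangeUnitary_conj_projector (hW : Wᴴ * W = 1) (W' : Matrix κ ρ' ℂ)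
    (hY : IsUnitaryMap Y) :
    (exchangeUnitary W W' Y)ᴴ * Matrix.fromBlocks (W * Wᴴ) 0 0 (0 : Matrix κ κ ℂ) *
      exchangeUnitary W W' Y = Matrix.fromBlocks (W' * W'ᴴ) 0 0 (0 : Matrix ι ι ℂ) := by
  have hYc' : ∀ B : Matrix ρ' κ ℂ, Yᴴ * (Y * B) = B := fun B => by
    rw [← Matrix.mul_assoc, hY.1, Matrix.one_mul]
  rw [exchangeUnitary_conjTranspose, exchangeUnitary, exchangeUnitary, Matrix.fromBlocks_multiply,
    Matrix.fromBlocks_multiply]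
  simp only [Matrix.conjTranspose_conjTranspose, Matrix.mul_sub, Matrix.sub_mul, Matrix.mul_one,
    Matrix.one_mul, Matrix.mul_assoc, mul_isometry_cancel hW, hYc', sub_self,
    add_zero, Matrix.mul_zero, Matrix.zero_mul]

theorem norm_mul_compl_le {U : Matrix ι ι ℂ} {ε : ℝ} (hW : Wᴴ * W = 1)
    (hU : ‖W * Wᴴ * U - U * (W * Wᴴ)‖ ≤ ε) : ‖Wᴴ * U * (1 - W * Wᴴ)‖ ≤ ε := by
  have h : Wᴴ * U * (1 - W * Wᴴ) = Wᴴ * (W * Wᴴ * U - U * (W * Wᴴ)) := by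
    simp only [Matrix.mul_sub, Matrix.mul_one, Matrix.mul_assoc, mul_isometry_cancel hW]
  have hn : ‖Wᴴ‖ ≤ 1 := (Matrix.l2_opNorm_conjTranspose _).trans_le (l2_opNorm_le_one_of_isometry hW)
  rw [h]
  simpa using l2_opNorm_mul_le_of_le hn hU

theorem norm_compl_mul_le {U : Matrix ι ι ℂ} {ε : ℝ} (hW : Wᴴ * W = 1)
    (hU : ‖W * Wᴴ * U - U * (W * Wᴴ)‖ ≤ ε) : ‖(1 - W * Wᴴ) * U * W‖ ≤ ε := by
  have h : (1 - W * Wᴴ) * U * W = -((W * Wᴴ * U - U * (W * Wᴴ)) * W) := by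
    simp only [Matrix.sub_mul, Matrix.one_mul, Matrix.mul_assoc, hW, Matrix.mul_one, neg_sub]
  rw [h, norm_neg]
  simpa using l2_opNorm_mul_le_of_le hU (l2_opNorm_le_one_of_isometry hW)

/-- Beyond the change of the corner, what is lost is the two off-diagonal blocks of `U`, each of
norm at most `ε`. -/
theorem norm_block_diag_le {U : Matrix ι ι ℂ} {ε : ℝ} (hW : Wᴴ * W = 1)
    (hU : ‖W * Wᴴ * U - U * (W * Wᴴ)‖ ≤ ε) {B : Matrix ρ ρ ℂ} {δ : ℝ}
    (hB : ‖B - Wᴴ * U * W‖ ≤ δ) :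
    ‖W * B * Wᴴ + (1 - W * Wᴴ) * U * (1 - W * Wᴴ) - U‖ ≤ δ + 2 * ε := by
  have h : W * B * Wᴴ + (1 - W * Wᴴ) * U * (1 - W * Wᴴ) - U =
      W * (B - Wᴴ * U * W) * Wᴴ - W * (Wᴴ * U * (1 - W * Wᴴ)) - ((1 - W * Wᴴ) * U * W) * Wᴴ := by
    simp only [Matrix.mul_sub, Matrix.sub_mul, Matrix.mul_one, Matrix.one_mul, Matrix.mul_assoc]
    abel
  have h1 := l2_opNorm_isometry_conj_le hW (B - Wᴴ * U * W)
  have hn := l2_opNorm_le_one_of_isometry hW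
  have hn' : ‖Wᴴ‖ ≤ 1 := (Matrix.l2_opNorm_conjTranspose _).trans_le hn
  have h2 := l2_opNorm_mul_le_of_le hn (norm_mul_compl_le hW hU)
  have h3 := l2_opNorm_mul_le_of_le (norm_compl_mul_le hW hU) hn'
  rw [h]
  refine (norm_sub_le _ _).trans ?_
  refine (add_le_add_left (norm_sub_le _ _) _).trans ?_
  linarith

theorem norm_block_offdiag_le {U : Matrix ι ι ℂ} {V : Matrix κ κ ℂ} {ε η : ℝ} (hW : Wᴴ * W = 1)
    (hW' : W'ᴴ * W' = 1) (hU : ‖W * Wᴴ * U - U * (W * Wᴴ)‖ ≤ ε)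
    (hV : ‖W' * W'ᴴ * V - V * (W' * W'ᴴ)‖ ≤ η) (hY : IsUnitaryMap Y) :
    ‖W' * Yᴴ * Wᴴ * U * (1 - W * Wᴴ) + (1 - W' * W'ᴴ) * V * (W' * Yᴴ * Wᴴ)‖ ≤ ε + η := by
  have hYn : ‖Yᴴ‖ ≤ 1 := (Matrix.l2_opNorm_conjTranspose _).trans_le
    (l2_opNorm_le_one_of_isometry hY.1)
  have hn := l2_opNorm_le_one_of_isometry hW'
  have hn' : ‖Wᴴ‖ ≤ 1 := (Matrix.l2_opNorm_conjTranspose _).trans_le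
    (l2_opNorm_le_one_of_isometry hW)
  have h1 := l2_opNorm_mul_le_of_le (l2_opNorm_mul_le_of_le hn hYn) (norm_mul_compl_le hW hU)
  have h2 := l2_opNorm_mul_le_of_le (norm_compl_mul_le hW' hV) (l2_opNorm_mul_le_of_le hYn hn')
  have h : W' * Yᴴ * Wᴴ * U * (1 - W * Wᴴ) + (1 - W' * W'ᴴ) * V * (W' * Yᴴ * Wᴴ) =
      W' * Yᴴ * (Wᴴ * U * (1 - W * Wᴴ)) + (1 - W' * W'ᴴ) * V * W' * (Yᴴ * Wᴴ) := by
    simp only [Matrix.mul_assoc]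
  rw [h]
  refine (norm_add_le _ _).trans ?_
  linarith

theorem norm_exchangeUnitary_conj_sub_le {U : Matrix ι ι ℂ} {V : Matrix κ κ ℂ} {ε η δ : ℝ}
    (hW : Wᴴ * W = 1)
    (hW' : W'ᴴ * W' = 1) (hU : ‖W * Wᴴ * U - U * (W * Wᴴ)‖ ≤ ε)
    (hV : ‖W' * W'ᴴ * V - V * (W' * W'ᴴ)‖ ≤ η) (hY : IsUnitaryMap Y)
    (hδ : ‖Yᴴ * (Wᴴ * U * W) * Y - W'ᴴ * V * W'‖ ≤ δ) :
    ‖(exchangeUnitary W W' Y)ᴴ * Matrix.fromBlocks U 0 0 V * exchangeUnitary W W' Y -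
      Matrix.fromBlocks V 0 0 U‖ ≤ δ + 3 * (ε + η) := by
  have hε : 0 ≤ ε := (norm_nonneg _).trans hU
  have hη : 0 ≤ η := (norm_nonneg _).trans hV
  have hY' : IsUnitaryMap Yᴴ := ⟨by simpa using hY.2, by simpa using hY.1⟩
  have hδ' : ‖Y * (W'ᴴ * V * W') * Yᴴ - Wᴴ * U * W‖ ≤ δ := by
    have h : Y * (W'ᴴ * V * W') * Yᴴ - Wᴴ * U * W =
        -(Y * (Yᴴ * (Wᴴ * U * W) * Y - W'ᴴ * V * W') * Yᴴ) := by
      have h1 : Y * (Yᴴ * (Wᴴ * U * W) * Y) * Yᴴ = Wᴴ * U * W := by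
        rw [← Matrix.mul_assoc, ← Matrix.mul_assoc, hY.2, Matrix.one_mul, Matrix.mul_assoc, hY.2,
          Matrix.mul_one]
      rw [Matrix.mul_sub, Matrix.sub_mul, h1, neg_sub]
    rw [h, norm_neg]
    exact (l2_opNorm_isometry_conj_le hY.1 _).trans hδ
  -- The diagonal blocks carry transported corners together with unchanged complementary blocks,
  -- costing `δ + 2 * (ε + η)`. The rest is built from off-diagonal blocks of `U` and `V`, costing
  -- `ε + η`.
  have hsplit : (exchangeUnitary W W' Y)ᴴ * Matrix.fromBlocks U 0 0 V * exchangeUnitary W W' Y -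
      Matrix.fromBlocks V 0 0 U =
      Matrix.fromBlocks
        (W' * (Yᴴ * (Wᴴ * U * W) * Y) * W'ᴴ + (1 - W' * W'ᴴ) * V * (1 - W' * W'ᴴ) - V) 0 0
        (W * (Y * (W'ᴴ * V * W') * Yᴴ) * Wᴴ + (1 - W * Wᴴ) * U * (1 - W * Wᴴ) - U) +
      Matrix.fromBlocks 0
        (W' * Yᴴ * Wᴴ * U * (1 - W * Wᴴ) + (1 - W' * W'ᴴ) * V * (W' * Yᴴ * Wᴴ))
        (W * Yᴴᴴ * W'ᴴ * V * (1 - W' * W'ᴴ) + (1 - W * Wᴴ) * U * (W * Yᴴᴴ * W'ᴴ)) 0 := by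
    rw [sub_eq_iff_eq_add, exchangeUnitary_conjTranspose, exchangeUnitary, exchangeUnitary,
      Matrix.fromBlocks_multiply, Matrix.fromBlocks_multiply, Matrix.fromBlocks_add,
      Matrix.fromBlocks_add]
    simp only [Matrix.mul_zero, add_zero, zero_add, sub_add_cancel,
      Matrix.conjTranspose_conjTranspose, Matrix.mul_assoc]
    congr 1
    · rw [add_comm ((1 - W * Wᴴ) * _)]
    · rw [add_comm ((1 - W * Wᴴ) * _)]
  rw [hsplit]
  have h1 := norm_block_diag_le hW' hV hδ
  have h2 := norm_block_diag_le hW hU hδ'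
  have h3 := norm_block_offdiag_le hW hW' hU hV hY
  have h4 := norm_block_offdiag_le hW' hW hV hU hY'
  have h5 := l2_opNorm_fromBlocks_diag_le (c := δ + 2 * (ε + η)) (h1.trans (by linarith))
    (h2.trans (by linarith))
  have h6 := l2_opNorm_fromBlocks_antidiag_le h3 (h4.trans_eq (add_comm _ _))
  refine (norm_add_le _ _).trans ?_
  linarith

theorem dist_le_of_corner_close {d : ℕ} {n m : ℕ} {L : ProjTuple d (Fin n)}
    {M : ProjTuple d (Fin m)} {ε η δ : ℝ} (hL : L.IsLocal ε) (hM : M.IsLocal η)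
    {W : Matrix (Fin n) ρ ℂ} {W' : Matrix (Fin m) ρ' ℂ} {Y : Matrix ρ ρ' ℂ} (hW : Wᴴ * W = 1)
    (hW' : W'ᴴ * W' = 1) (hLW : L.P = W * Wᴴ) (hMW : M.P = W' * W'ᴴ) (hY : IsUnitaryMap Y)
    (hδ : ∀ i, ‖Yᴴ * (Wᴴ * L.U i * W) * Y - W'ᴴ * M.U i * W'‖ ≤ δ) :
    ProjTuple.dist L M ≤ ENNReal.ofReal (δ + 3 * (ε + η)) := by
  -- Each side receives the unitaries of the other with projector `0`; sizes and ranks then agree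
  -- even if `n ≠ m`.
  let R : ProjTuple d (Fin m) := ⟨M.U, 0⟩
  let S : ProjTuple d (Fin n) := ⟨L.U, 0⟩
  have hR : R.IsTrivial := ⟨⟨hM.1.unitary, hM.1.commute, .zero _⟩, fun i => by simp [R]⟩
  have hS : S.IsTrivial := ⟨⟨hL.1.unitary, hL.1.commute, .zero _⟩, fun i => by simp [S]⟩
  refine iInf_le_of_le m (iInf_le_of_le n (iInf_le_of_le R (iInf_le_of_le S
    (iInf_le_of_le ⟨hR, hS⟩ (iInf_le_of_le (exchangeUnitary W W' Y) (iInf_le_of_le ⟨?_, ?_⟩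
      (iSup_le fun i => ENNReal.ofReal_le_ofReal ?_)))))))
  · exact exchangeUnitary_isUnitaryMap hW hW' hY
  · simp only [ProjTuple.add, hLW, hMW, R, S]
    exact exchangeUnitary_conj_projector hW W' hY
  · exact norm_exchangeUnitary_conj_sub_le hW hW' (hLW ▸ hL.2 i) (hMW ▸ hM.2 i) hY (hδ i)

end Distance

/-! ### Corners of unitaries and their polar parts -/

section Corner

variable {ι ρ : Type*} [Fintype ι] [DecidableEq ι] [Fintype ρ] [DecidableEq ρ]

/-- The eigenvalues of `Aᴴ * A` lie in `[1 - s, 1]` and `A = polar A * √(Aᴴ * A)`, so everything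
reduces to a scalar bound on `√t`. The free scale `c` permits a comparison with a rescaled unitary.
-/
theorem polar_mem_unitaryGroup_and_norm_sub_le {A : Matrix ρ ρ ℂ} {s : ℝ} (hs : s < 1)
    (hA : ‖A‖ ≤ 1) (hA1 : ‖1 - Aᴴ * A‖ ≤ s) :
    polar A ∈ Matrix.unitaryGroup ρ ℂ ∧ ∀ c κ : ℝ, 0 ≤ κ →
      (∀ t, 1 - s ≤ t → t ≤ 1 → |√t - c| ≤ κ) → ‖A - (c : ℂ) • polar A‖ ≤ κ := by
  obtain ⟨φ, t, hφ, hn⟩ := (Matrix.isHermitian_conjTranspose_mul_self A).exists_starAlgHom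
  have ht1 : ∀ a, t a ≤ 1 := fun a => by
    have h1 : ‖(fun a => (t a : ℂ))‖ ≤ 1 := by
      rw [← hn, hφ, Matrix.l2_opNorm_conjTranspose_mul_self]
      nlinarith [norm_nonneg A]
    have h2 := (norm_le_pi_norm (fun a => (t a : ℂ)) a).trans h1
    rw [Complex.norm_real] at h2
    exact (le_abs_self _).trans h2
  have hts : ∀ a, 1 - s ≤ t a := fun a => by
    have h1 : ‖(1 : ρ → ℂ) - fun a => (t a : ℂ)‖ ≤ s := by
      rwa [← hn, map_sub, map_one, hφ]
    have h2 := (norm_le_pi_norm ((1 : ρ → ℂ) - fun a => (t a : ℂ)) a).trans h1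
    rw [Pi.sub_apply, Pi.one_apply, ← Complex.ofReal_one, ← Complex.ofReal_sub,
      Complex.norm_real] at h2
    linarith [le_abs_self (1 - t a), h2.trans' (le_of_eq (Real.norm_eq_abs _).symm)]
  have ht0 : ∀ a, 0 < t a := fun a => by linarith [hts a]
  have hpol : polar A = A * φ fun a => ((t a ^ (-(1 / 2) : ℝ) : ℝ) : ℂ) := by
    rw [polar, ← hφ, cfc_starAlgHom_ofReal]
  have hr : ∀ a, t a ^ (-(1 / 2) : ℝ) * √(t a) = 1 := fun a => by
    rw [Real.sqrt_eq_rpow, ← Real.rpow_add (ht0 a)]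
    norm_num
  have hU : polar A ∈ Matrix.unitaryGroup ρ ℂ := by
    rw [Matrix.mem_unitaryGroup_iff', Matrix.star_eq_conjTranspose, hpol,
      Matrix.conjTranspose_mul, conjTranspose_starAlgHom, Matrix.mul_assoc, ← Matrix.mul_assoc Aᴴ,
      ← hφ, ← map_mul, ← map_mul, ← map_one φ]
    congr 1
    ext a
    simp only [Pi.mul_apply, Pi.star_apply, Complex.star_def, Complex.conj_ofReal, Pi.one_apply]
    have h1 : t a ^ (-(1 / 2) : ℝ) * (t a * t a ^ (-(1 / 2) : ℝ)) = 1 := by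
      have h2 := hr a
      have h3 := Real.mul_self_sqrt (ht0 a).le
      calc t a ^ (-(1 / 2) : ℝ) * (t a * t a ^ (-(1 / 2) : ℝ))
          = (t a ^ (-(1 / 2) : ℝ) * √(t a)) * (t a ^ (-(1 / 2) : ℝ) * √(t a)) := by
            nth_rewrite 2 [← h3]
            ring
        _ = 1 := by rw [h2, one_mul]
    exact_mod_cast h1
  refine ⟨hU, fun c κ hκ hc => ?_⟩
  have h1 : A - (c : ℂ) • polar A = polar A * φ (fun a => ((√(t a) - c : ℝ) : ℂ)) := by
    have h2 : A = polar A * φ (fun a => (√(t a) : ℂ)) := by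
      rw [hpol, Matrix.mul_assoc, ← map_mul]
      have h3 : ((fun a => ((t a ^ (-(1 / 2) : ℝ) : ℝ) : ℂ)) * fun a => (√(t a) : ℂ)) = 1 := by
        ext a
        simp only [Pi.mul_apply, Pi.one_apply]
        exact_mod_cast hr a
      rw [h3, map_one, Matrix.mul_one]
    have h4 : (fun a => ((√(t a) - c : ℝ) : ℂ)) = (fun a => (√(t a) : ℂ)) - (c : ℂ) • 1 := by
      ext a
      simp
    rw [h4, map_sub, map_smul, map_one, Matrix.mul_sub, ← h2, Matrix.mul_smul, Matrix.mul_one]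
  rw [h1]
  have h5 : ‖φ (fun a => ((√(t a) - c : ℝ) : ℂ))‖ ≤ κ := by
    rw [hn]
    refine (pi_norm_le_iff_of_nonneg hκ).2 fun a => ?_
    rw [Complex.norm_real]
    exact hc _ (hts a) (ht1 a)
  simpa using l2_opNorm_mul_le_of_le (l2_opNorm_le_one_of_mem_unitaryGroup hU) h5

variable {W : Matrix ι ρ ℂ} {U V : Matrix ι ι ℂ} {ε : ℝ}

/-- By unitarity of `U` the defect is `Bᴴ * B` for the off-diagonal block `B = (1 - W * Wᴴ) * U *
W`; hence the square. -/
theorem norm_one_sub_corner_le (hW : Wᴴ * W = 1) (hUu : U ∈ Matrix.unitaryGroup ι ℂ)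
    (hU : ‖W * Wᴴ * U - U * (W * Wᴴ)‖ ≤ ε) :
    ‖1 - (Wᴴ * U * W)ᴴ * (Wᴴ * U * W)‖ ≤ ε ^ 2 := by
  have hU1 : Uᴴ * U = 1 := Matrix.mem_unitaryGroup_iff'.1 hUu
  have h1 : 1 - (Wᴴ * U * W)ᴴ * (Wᴴ * U * W) =
      ((1 - W * Wᴴ) * U * W)ᴴ * ((1 - W * Wᴴ) * U * W) := by
    have h2 : Uᴴ * (U * W) = W := by rw [← Matrix.mul_assoc, hU1, Matrix.one_mul]
    simp only [Matrix.conjTranspose_mul, Matrix.conjTranspose_sub,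
      Matrix.conjTranspose_conjTranspose, Matrix.mul_sub, Matrix.sub_mul, Matrix.one_mul,
      Matrix.mul_assoc, h2, hW, mul_isometry_cancel hW]
    abel
  have h3 := norm_compl_mul_le hW hU
  rw [h1, Matrix.l2_opNorm_conjTranspose_mul_self, sq]
  exact mul_self_le_mul_self (norm_nonneg _) h3

/-- Since `U` and `V` commute, the corner of the full commutator vanishes, and only products of two
off-diagonal blocks survive. -/
theorem norm_corner_commutator_le (hW : Wᴴ * W = 1) (hUV : U * V = V * U)
    (hU : ‖W * Wᴴ * U - U * (W * Wᴴ)‖ ≤ ε) (hV : ‖W * Wᴴ * V - V * (W * Wᴴ)‖ ≤ ε) :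
    ‖(Wᴴ * U * W) * (Wᴴ * V * W) - (Wᴴ * V * W) * (Wᴴ * U * W)‖ ≤ 2 * ε ^ 2 := by
  have h1 : (Wᴴ * U * W) * (Wᴴ * V * W) - (Wᴴ * V * W) * (Wᴴ * U * W) =
      Wᴴ * V * (1 - W * Wᴴ) * ((1 - W * Wᴴ) * U * W) -
        Wᴴ * U * (1 - W * Wᴴ) * ((1 - W * Wᴴ) * V * W) := by
    have h2 : U * (V * W) = V * (U * W) := by rw [← Matrix.mul_assoc, hUV, Matrix.mul_assoc]
    simp only [Matrix.mul_sub, Matrix.sub_mul, Matrix.one_mul, Matrix.mul_one, Matrix.mul_assoc,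
      mul_isometry_cancel hW, h2]
    abel
  have h3 := l2_opNorm_mul_le_of_le (norm_mul_compl_le hW hV) (norm_compl_mul_le hW hU)
  have h4 := l2_opNorm_mul_le_of_le (norm_mul_compl_le hW hU) (norm_compl_mul_le hW hV)
  rw [h1]
  refine (norm_sub_le _ _).trans ?_
  linarith

theorem norm_corner_le_one (hW : Wᴴ * W = 1) (hUu : U ∈ Matrix.unitaryGroup ι ℂ) :
    ‖Wᴴ * U * W‖ ≤ 1 :=
  (l2_opNorm_conj_isometry_le hW U).trans (l2_opNorm_le_one_of_mem_unitaryGroup hUu)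

theorem abs_sqrt_sub_one_le {s t : ℝ} (hs : s ≤ 1) (h1 : 1 - s ≤ t) (h2 : t ≤ 1) :
    |√t - 1| ≤ s := by
  have h3 : t ≤ √t := Real.le_sqrt_of_sq_le (by nlinarith)
  have h4 : √t ≤ 1 := Real.sqrt_le_one.2 h2
  exact abs_le.2 ⟨by linarith, by linarith⟩

theorem abs_sqrt_sub_le {s t : ℝ} (hs0 : 0 ≤ s) (hs : s ≤ 1 / 4) (h1 : 1 - s ≤ t) (h2 : t ≤ 1) :
    |√t - (1 - s / 4)| ≤ 0.3 * s := by
  have h3 : 1 - 0.55 * s ≤ √t := Real.le_sqrt_of_sq_le (by nlinarith)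
  have h4 : √t ≤ 1 := Real.sqrt_le_one.2 h2
  exact abs_le.2 ⟨by linarith, by linarith⟩

/-- The scale `1 - s / 4` sits near the middle of the range of `√t`, so the replacement errors total
`4 * 0.3 * s`. With the `2 * s` of the corners this is `3.2 * s`, and `c ^ 2 ≥ 0.8` gives exactly `4
* s`. At scale `1` the bound `√t ≥ 1 - 0.55 * s` would give `4.2 * s`. -/
theorem norm_commutator_le_of_norm_sub_smul_le {A B S T : Matrix ρ ρ ℂ} {s : ℝ} (hs0 : 0 ≤ s)
    (hs : s ≤ 1 / 4) (hA : ‖A‖ ≤ 1) (hT : ‖T‖ ≤ 1)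
    (hAB : ‖A * B - B * A‖ ≤ 2 * s) (hAS : ‖A - ((1 - s / 4 : ℝ) : ℂ) • S‖ ≤ 0.3 * s)
    (hBT : ‖B - ((1 - s / 4 : ℝ) : ℂ) • T‖ ≤ 0.3 * s) : ‖S * T - T * S‖ ≤ 4 * s := by
  set c : ℝ := 1 - s / 4 with hc
  have hc0 : 0 ≤ c := by linarith
  have hcT : ‖(c : ℂ) • T‖ ≤ 1 := by
    rw [norm_smul, Complex.norm_real, Real.norm_eq_abs, abs_of_nonneg hc0]
    nlinarith [norm_nonneg T]
  have h1 : ((c ^ 2 : ℝ) : ℂ) • (S * T - T * S) = (A * B - B * A) -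
      ((A - (c : ℂ) • S) * ((c : ℂ) • T) - ((c : ℂ) • T) * (A - (c : ℂ) • S)) -
      (A * (B - (c : ℂ) • T) - (B - (c : ℂ) • T) * A) := by
    simp only [Matrix.mul_sub, Matrix.sub_mul, Matrix.smul_mul, Matrix.mul_smul, smul_smul,
      smul_sub]
    push_cast
    rw [sq]
    abel
  have h2 := congrArg norm h1
  rw [norm_smul, Complex.norm_real, Real.norm_eq_abs, abs_of_nonneg (sq_nonneg c)] at h2
  have h3 := l2_opNorm_mul_le_of_le hAS hcT
  have h4 := l2_opNorm_mul_le_of_le hcT hAS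
  have h5 := l2_opNorm_mul_le_of_le hA hBT
  have h6 := l2_opNorm_mul_le_of_le hBT hA
  have h7 : c ^ 2 * ‖S * T - T * S‖ ≤ 3.2 * s := by
    rw [h2]
    refine (norm_sub_le _ _).trans ((add_le_add (norm_sub_le _ _) (norm_sub_le _ _)).trans ?_)
    have h8 := norm_sub_le ((A - (c : ℂ) • S) * ((c : ℂ) • T)) (((c : ℂ) • T) * (A - (c : ℂ) • S))
    linarith
  have h9 : (0.8 : ℝ) ≤ c ^ 2 := by nlinarith
  nlinarith [norm_nonneg (S * T - T * S)]

end Corner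

/-! ### Values of `𝒢` and their existence -/

section MapG

variable {ι ρ : Type*} [Fintype ι] [DecidableEq ι] [Fintype ρ] [DecidableEq ρ] {d : ℕ}
  {L : ProjTuple d ι} {S : Fin d → Matrix ρ ρ ℂ} {ε : ℝ}

theorem ProjTuple.IsLocal.nonneg (hL : L.IsLocal ε) (hd : 0 < d) : 0 ≤ ε :=
  (norm_nonneg _).trans (hL.2 ⟨0, hd⟩)

theorem IsMapG.exists_isometry (hL : L.IsLocal ε) (hε : ε < 1) (hd : 0 < d) (hS : IsMapG L S) :
    ∃ W : Matrix ι ρ ℂ, Wᴴ * W = 1 ∧ L.P = W * Wᴴ ∧ ∀ i, ‖Wᴴ * L.U i * W - S i‖ ≤ ε ^ 2 := by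
  obtain ⟨W, hW, hP, hSi⟩ := hS
  have hε0 := hL.nonneg hd
  refine ⟨W, hW, hP.symm, fun i => ?_⟩
  have hs : ε ^ 2 < 1 := by nlinarith
  have hU := hL.1.unitary i
  have h := (polar_mem_unitaryGroup_and_norm_sub_le hs (norm_corner_le_one hW hU)
    (norm_one_sub_corner_le hW hU (hP ▸ hL.2 i))).2 1 (ε ^ 2) (sq_nonneg _)
    fun t => abs_sqrt_sub_one_le hs.le
  rwa [Complex.ofReal_one, one_smul, ← hSi] at h

theorem IsMapG.isSoftTorus (hL : L.IsLocal ε) (hε : ε ≤ 1 / 2) (hd : 0 < d) (hS : IsMapG L S) :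
    IsSoftTorus (4 * ε ^ 2) S := by
  obtain ⟨W, hW, hP, hSi⟩ := hS
  have hε0 := hL.nonneg hd
  have hs : ε ^ 2 ≤ 1 / 4 := by nlinarith
  have hloc : ∀ i, ‖W * Wᴴ * L.U i - L.U i * (W * Wᴴ)‖ ≤ ε := fun i => hP ▸ hL.2 i
  have h := fun i => polar_mem_unitaryGroup_and_norm_sub_le (lt_of_le_of_lt hs (by norm_num))
    (norm_corner_le_one hW (hL.1.unitary i)) (norm_one_sub_corner_le hW (hL.1.unitary i) (hloc i))
  have hn := fun i => l2_opNorm_le_one_of_mem_unitaryGroup (h i).1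
  have hc := fun i => (h i).2 (1 - ε ^ 2 / 4) (0.3 * ε ^ 2) (by positivity)
    fun t => abs_sqrt_sub_le (sq_nonneg ε) hs
  refine ⟨fun i => hSi i ▸ (h i).1, fun i j => ?_⟩
  rw [hSi, hSi]
  exact norm_commutator_le_of_norm_sub_smul_le (sq_nonneg ε) hs
    (norm_corner_le_one hW (hL.1.unitary i)) (hn j)
    (norm_corner_commutator_le hW (hL.1.commute i j) (hloc i) (hloc j)) (hc i) (hc j)

/-- The eigenvalues are `0` or `1`; the eigenvectors for `1` are the columns of `W`. -/
theorem exists_isometry_of_isStarProjection {P : Matrix ι ι ℂ} (hP : IsStarProjection P) :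
    ∃ (r : ℕ) (W : Matrix ι (Fin r) ℂ), Wᴴ * W = 1 ∧ W * Wᴴ = P := by
  have hH : P.IsHermitian := hP.isSelfAdjoint
  obtain ⟨U, t, hUU, hUU', hsp⟩ : ∃ (U : Matrix ι ι ℂ) (t : ι → ℝ), Uᴴ * U = 1 ∧ U * Uᴴ = 1 ∧
      P = U * Matrix.diagonal (fun a => (t a : ℂ)) * Uᴴ :=
    ⟨hH.eigenvectorUnitary.1, hH.eigenvalues,
      Matrix.mem_unitaryGroup_iff'.1 hH.eigenvectorUnitary.2,
      Matrix.mem_unitaryGroup_iff.1 hH.eigenvectorUnitary.2, hH.spectral_theorem⟩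
  have hdiag : Matrix.diagonal (fun a => (t a : ℂ)) = Uᴴ * P * U := by
    rw [hsp, Matrix.mul_assoc, Matrix.mul_assoc, hUU, ← Matrix.mul_assoc, ← Matrix.mul_assoc, hUU,
      Matrix.one_mul, Matrix.mul_one]
  have h01 : ∀ a, t a = 0 ∨ t a = 1 := by
    intro a
    have h1 : Matrix.diagonal (fun a => (t a : ℂ)) *
        Matrix.diagonal (fun a => (t a : ℂ)) =
        Matrix.diagonal (fun a => (t a : ℂ)) := by
      rw [hdiag, Matrix.mul_assoc (Uᴴ * P), ← Matrix.mul_assoc U, ← Matrix.mul_assoc U, hUU',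
        Matrix.one_mul, ← Matrix.mul_assoc, Matrix.mul_assoc Uᴴ P P, hP.isIdempotentElem]
    rw [Matrix.diagonal_mul_diagonal] at h1
    have h2 := congrFun (Matrix.diagonal_injective h1) a
    have h3 : t a * t a = t a := by exact_mod_cast h2
    have h4 : t a * (t a - 1) = 0 := by linarith
    rcases mul_eq_zero.1 h4 with h | h
    · exact Or.inl h
    · exact Or.inr (by linarith)
  classical
  let J := {a // t a = 1}
  let e : Fin (Fintype.card J) ≃ J := (Fintype.equivFin J).symm
  refine ⟨Fintype.card J, U.submatrix id fun k => (e k : ι), ?_, ?_⟩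
  · ext k l
    have h1 := congrFun (congrFun hUU (e k)) (e l)
    rw [Matrix.mul_apply] at h1 ⊢
    simp only [Matrix.conjTranspose_apply, Matrix.submatrix_apply, id] at h1 ⊢
    rw [h1, Matrix.one_apply, Matrix.one_apply]
    simp [Subtype.ext_iff.symm]
  · ext i j
    rw [hsp, Matrix.mul_apply, Matrix.mul_apply]
    simp only [Matrix.mul_diagonal, Matrix.conjTranspose_apply, Matrix.submatrix_apply, id]
    rw [e.sum_comp (fun a : J => U i a * star (U j a)),
      ← Fintype.sum_subtype_add_sum_subtype (fun a => t a = 1)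
        fun a => U i a * (t a : ℂ) * star (U j a)]
    have h1 : ∑ a : {a // ¬t a = 1},
        U i a * (t a : ℂ) * star (U j a) = 0 := by
      refine Finset.sum_eq_zero fun a _ => ?_
      rw [(h01 a).resolve_right a.2]
      simp
    rw [h1, add_zero]
    refine Finset.sum_congr rfl fun a _ => ?_
    rw [a.2]
    simp

open scoped ComplexOrder in
theorem rank_isometry_mul_conjTranspose {W : Matrix ι ρ ℂ} (hW : Wᴴ * W = 1) :
    (W * Wᴴ).rank = Fintype.card ρ := by
  rw [Matrix.rank_self_mul_conjTranspose, ← Matrix.rank_conjTranspose_mul_self, hW,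
    Matrix.rank_one]

end MapG

/-! ### Assembling the constants -/

theorem sqrt_sqrt_le {d : ℕ} {ε : ℝ} (hε : 0 ≤ ε) :
    √√(d * (4 * ε ^ 2)) ≤ 2 * ((d : ℝ) ^ (1 / 4 : ℝ) * ε ^ (1 / 2 : ℝ)) := by
  have h1 : ((d : ℝ) ^ (1 / 4 : ℝ)) ^ 4 = d := by
    rw [← Real.rpow_natCast, ← Real.rpow_mul (Nat.cast_nonneg d)]
    norm_num
  have h2 : (ε ^ (1 / 2 : ℝ)) ^ 2 = ε := by
    rw [← Real.rpow_natCast, ← Real.rpow_mul hε]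
    norm_num
  set p := (d : ℝ) ^ (1 / 4 : ℝ)
  set q := ε ^ (1 / 2 : ℝ)
  have hp : 0 ≤ p := by positivity
  have hq : 0 ≤ q := by positivity
  refine Real.sqrt_le_iff.2 ⟨by positivity, Real.sqrt_le_iff.2 ⟨by positivity, ?_⟩⟩
  rw [← h1, ← h2]
  have : 0 ≤ p ^ 4 * q ^ 4 := by positivity
  nlinarith

theorem dist_le_torusDist_add {d : ℕ} (hd : 0 < d) {ε : ℝ} (hε : ε < 1) {n m : ℕ}
    {L : ProjTuple d (Fin n)} {M : ProjTuple d (Fin m)} (hL : L.IsLocal ε) (hM : M.IsLocal ε)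
    {ρ ρ' : Type*} [Fintype ρ] [DecidableEq ρ] [Fintype ρ'] [DecidableEq ρ']
    {S : Fin d → Matrix ρ ρ ℂ} {T : Fin d → Matrix ρ' ρ' ℂ} (hS : IsMapG L S) (hT : IsMapG M T) :
    ProjTuple.dist L M ≤ torusDist S T + ENNReal.ofReal (8 * ε) := by
  obtain ⟨W, hW, hLW, hWS⟩ := hS.exists_isometry hL hε hd
  obtain ⟨W', hW', hMW, hWT⟩ := hT.exists_isometry hM hε hd
  have hε0 := hL.nonneg hd
  simp_rw [torusDist, ENNReal.iInf_add]
  refine le_iInf fun Y => le_iInf fun hY => ?_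
  set D := ⨆ i, ENNReal.ofReal ‖Yᴴ * S i * Y - T i‖ with hD
  by_cases hDtop : D = ⊤
  · simp [hDtop]
  have hDi : ∀ i, ‖Yᴴ * S i * Y - T i‖ ≤ D.toReal := fun i =>
    (ENNReal.ofReal_le_iff_le_toReal hDtop).1
      (le_iSup (fun i => ENNReal.ofReal ‖Yᴴ * S i * Y - T i‖) i)
  -- Each corner is `ε ^ 2` from its polar part; with the `6 * ε` of the exchange and `ε < 1` the
  -- total excess is at most `8 * ε`.
  have hδ : ∀ i, ‖Yᴴ * (Wᴴ * L.U i * W) * Y - W'ᴴ * M.U i * W'‖ ≤ D.toReal + 2 * ε ^ 2 := by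
    intro i
    have h1 : Yᴴ * (Wᴴ * L.U i * W) * Y - W'ᴴ * M.U i * W' =
        Yᴴ * (Wᴴ * L.U i * W - S i) * Y + (Yᴴ * S i * Y - T i) -
          (W'ᴴ * M.U i * W' - T i) := by
      rw [Matrix.mul_sub, Matrix.sub_mul]
      abel
    rw [h1]
    refine (norm_sub_le _ _).trans ((add_le_add_left (norm_add_le _ _) _).trans ?_)
    linarith [hDi i, hWT i, (l2_opNorm_conj_isometry_le hY.1 (Wᴴ * L.U i * W - S i)).trans (hWS i)]
  refine (dist_le_of_corner_close hL hM hW hW' hLW hMW hY hδ).trans ?_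
  rw [← ENNReal.ofReal_toReal hDtop, ← ENNReal.ofReal_add ENNReal.toReal_nonneg (by positivity)]
  refine ENNReal.ofReal_le_ofReal ?_
  rw [ENNReal.toReal_ofReal ENNReal.toReal_nonneg]
  nlinarith

theorem mul_rpow_le_rpow {d : ℕ} (hd : 0 < d) {ε : ℝ} (hε : 0 < ε) (hε1 : ε ≤ 1) :
    ε ≤ ((d : ℝ) * ε) ^ (1 / 4 : ℝ) ∧
      (d : ℝ) ^ (1 / 4 : ℝ) * ε ^ (1 / 2 : ℝ) ≤ ((d : ℝ) * ε) ^ (1 / 4 : ℝ) := by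
  have hd1 : (1 : ℝ) ≤ d := by exact_mod_cast hd
  constructor
  · calc ε = ε ^ (1 : ℝ) := (Real.rpow_one ε).symm
      _ ≤ ε ^ (1 / 4 : ℝ) := Real.rpow_le_rpow_of_exponent_ge hε hε1 (by norm_num)
      _ ≤ _ := Real.rpow_le_rpow hε.le (by nlinarith) (by norm_num)
  · rw [Real.mul_rpow (by positivity) hε.le]
    exact mul_le_mul_of_nonneg_left
      (Real.rpow_le_rpow_of_exponent_ge hε hε1 (by norm_num)) (by positivity)

theorem IsMapF.isLocal_and_rank_and_dist_le {F : ℝ → ℝ} (hF : IsWindow F) {K : ℝ}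
    (hK : IsAverageBound F K) (hK0 : 0 ≤ K) {d : ℕ} (hd : 0 < d) {ε : ℝ} (hε : 0 < ε)
    (hε1 : ε ≤ 1 / 2) {n r N : ℕ} {L : ProjTuple d (Fin n)} (hL : L.IsLocal ε)
    {S : Fin d → Matrix (Fin r) (Fin r) ℂ} (hS : IsMapG L S) {M : ProjTuple d (Fin N)}
    (hM : IsMapF F (4 * ε ^ 2) S M) {C₁ : ℝ} (hC₁ : C₁ = 6 * √(10 + 16 * K)) :
    M.IsLocal ((4 + 14 * C₁) * (d : ℝ) ^ (1 / 4 : ℝ) * ε ^ (1 / 2 : ℝ)) ∧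
      M.P.rank = L.P.rank ∧
      ProjTuple.dist L M ≤ ENNReal.ofReal ((4 + 14 * C₁) * ((d : ℝ) * ε) ^ (1 / 4 : ℝ)) := by
  obtain ⟨W, hW, hLW, hWS⟩ := hS.exists_isometry hL (by linarith) hd
  obtain ⟨hMex, W', hW', hMW, hclose⟩ := hM.exists_isometry_close hF hK hK0 hd (by positivity)
    (hS.isSoftTorus hL hε1 hd)
  rw [← hC₁] at hclose
  have hC₁0 : 0 ≤ C₁ := by rw [hC₁]; positivity
  set q := (d : ℝ) ^ (1 / 4 : ℝ) * ε ^ (1 / 2 : ℝ) with hq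
  have hq0 : 0 ≤ q := by positivity
  have hη : C₁ * √√(d * (4 * ε ^ 2)) ≤ 2 * C₁ * q := by
    have := mul_le_mul_of_nonneg_left (sqrt_sqrt_le (d := d) hε.le) hC₁0
    linarith
  obtain ⟨hp1, hp2⟩ := mul_rpow_le_rpow hd hε (by linarith)
  have hMloc : M.IsLocal (4 * C₁ * q) := by
    refine ⟨hMex, fun i => ?_⟩
    rw [hMW]
    refine (norm_commutator_projector_le hW' (hclose i).1 (hclose i).2).trans ?_
    linarith
  refine ⟨⟨hMex, fun i => (hMloc.2 i).trans ?_⟩, ?_, ?_⟩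
  · rw [mul_assoc (4 + 14 * C₁), ← hq]
    nlinarith [mul_nonneg hC₁0 hq0]
  · rw [hMW, hLW, rank_isometry_mul_conjTranspose hW, rank_isometry_mul_conjTranspose hW']
  -- Both corners are close to `S i` in the given bases, so `Y = 1` serves. The distance is at most
  -- `ε ^ 2 + 2 * C₁ * q + 3 * (ε + 4 * C₁ * q)`, whence the constant `4 + 14 * C₁`.
  · have hδ : ∀ i, ‖(1 : Matrix (Fin r) (Fin r) ℂ)ᴴ * (Wᴴ * L.U i * W) * 1 -
        W'ᴴ * M.U i * W'‖ ≤ ε ^ 2 + 2 * C₁ * q := by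
      intro i
      have h1 : (1 : Matrix (Fin r) (Fin r) ℂ)ᴴ * (Wᴴ * L.U i * W) * 1 - W'ᴴ * M.U i * W' =
          (Wᴴ * L.U i * W - S i) - W'ᴴ * (M.U i * W' - W' * S i) := by
        rw [Matrix.conjTranspose_one, Matrix.one_mul, Matrix.mul_one, Matrix.mul_sub,
          mul_isometry_cancel hW', Matrix.mul_assoc W'ᴴ]
        abel
      have hn : ‖W'ᴴ‖ ≤ 1 :=
        (Matrix.l2_opNorm_conjTranspose _).trans_le (l2_opNorm_le_one_of_isometry hW')
      rw [h1]
      refine (norm_sub_le _ _).trans ?_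
      linarith [hWS i, l2_opNorm_mul_le_of_le hn (hclose i).1]
    refine (dist_le_of_corner_close hL hMloc hW hW' hLW hMW (Y := 1)
      ⟨by simp, by simp⟩ hδ).trans (ENNReal.ofReal_le_ofReal ?_)
    have h2 := mul_le_mul_of_nonneg_left hp2 hC₁0
    nlinarith

end

theorem mainTheorem5 :
    (∃ C : ℝ, 0 < C ∧ ∀ (d : ℕ), 0 < d → ∀ (ε : ℝ), ε < 0.6 →
      ∀ (n n' : ℕ) (L : ProjTuple d (Fin n)) (M : ProjTuple d (Fin n')),
        L.IsLocal ε → M.IsLocal ε → L.P.rank = M.P.rank →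
        ∀ (r r' : ℕ) (S : Fin d → Matrix (Fin r) (Fin r) ℂ)
          (T : Fin d → Matrix (Fin r') (Fin r') ℂ),
          IsMapG L S → IsMapG M T →
          ProjTuple.dist L M ≤ torusDist S T + ENNReal.ofReal (C * ε)) ∧
    (∀ F : ℝ → ℝ, IsWindow F →
      ∃ C ε₀ : ℝ, 0 < C ∧ 0 < ε₀ ∧ ε₀ < 0.6 ∧
        ∀ (d : ℕ), 0 < d → ∀ (ε : ℝ), 0 < ε → ε ≤ ε₀ →
        ∀ (n : ℕ) (L : ProjTuple d (Fin n)), L.IsLocal ε →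
          (∃ (r : ℕ) (S : Fin d → Matrix (Fin r) (Fin r) ℂ), IsMapG L S) ∧
          ∀ (r : ℕ) (S : Fin d → Matrix (Fin r) (Fin r) ℂ), IsMapG L S →
            IsSoftTorus (4 * ε ^ 2) S ∧
            (∃ (N : ℕ) (M : ProjTuple d (Fin N)), IsMapF F (4 * ε ^ 2) S M) ∧
            ∀ (N : ℕ) (M : ProjTuple d (Fin N)), IsMapF F (4 * ε ^ 2) S M →
              M.IsLocal (C * (d : ℝ) ^ (1 / 4 : ℝ) * ε ^ (1 / 2 : ℝ)) ∧
              M.P.rank = L.P.rank ∧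
              ProjTuple.dist L M ≤ ENNReal.ofReal (C * ((d : ℝ) * ε) ^ (1 / 4 : ℝ))) := by
  refine ⟨⟨8, by norm_num, ?_⟩, fun F hF => ?_⟩
  · intro d hd ε hε n n' L M hL hM _ r r' S T hS hT
    exact dist_le_torusDist_add hd (by linarith) hL hM hS hT
  · obtain ⟨K, hK0, hK⟩ := hF.exists_norm_average_sub_le
    -- The threshold `1 / 2` ensures `ε ^ 2 ≤ 1 / 4`, as the soft torus estimate with constant `4`
    -- requires.
    refine ⟨4 + 14 * (6 * √(10 + 16 * K)), 1 / 2, by positivity, by norm_num, by norm_num, ?_⟩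
    intro d hd ε hε hε1 n L hL
    refine ⟨?_, fun r S hS => ⟨hS.isSoftTorus hL hε1 hd, ?_, fun N M hM => ?_⟩⟩
    · obtain ⟨r, W, hW, hP⟩ := exists_isometry_of_isStarProjection hL.1.projector
      exact ⟨r, _, W, hW, hP, fun i => rfl⟩
    · exact exists_isMapF hF hd (by positivity) (hS.isSoftTorus hL hε1 hd)
    · exact hM.isLocal_and_rank_and_dist_le hF hK hK0.le hd hε hε1 hL hS rfl
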